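/- Throughout, $\mathbb F,\mathbb F_1,\mathbb F_2$ denote nonabelian free groups of finite rank, $\mathbb F_1,\mathbb F_2$ with fixed finite bases $\mathcal B_1,\mathcal B_2$, and $g\ge 0$ is an integer. **Representations.** Let $H_g=\langle a_1,b_1,\dots,a_g,b_g\rangle$ be free of rank $2g$ and $\partial_g=[a_1,b_1]\cdots[a_g,b_g]$. A *genus $g$ representation* of $x\in\mathbb F$ is a homomorphism $h:H_g\to\mathbb F$ with $h(\partial_g)=x$. Two genus $g$ representations $h,h'$ of $x$ are related by a *fractional Dehn twist* if one of the following holds: * $H_g=A*_CB$ with $C$ cyclic and $\partial_g\in A$, and there is $z\in\mathbb F$ centralizing $h(C)$ such that $h'|_A=h|_A$ and $h'(b)=z\,h(b)\,z^{-1}$ for $b\in B$; * $H_g=\langle A,t\mid t^{-1}ct=\varphi(c),\ c\in C\rangle$ is an HNN extension with $C$ cyclic, $\varphi:C\to C'$ an isomorphism of subgroups of $A$, and $\partial_g\in A$, and there is $z\in\mathbb F$ centralizing $h(C)$ such that $h'|_A=h|_A$ and $h'(t)=z\,h(t)$. Let $\sim$ be the equivalence relation on the genus $g$ representations of $x$ generated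 by fractional Dehn twists. A representation is *$\sim$-injective* if every representation equivalent to it is injective. It is *admissible* if it is injective and its image is closed under taking roots in $\mathbb F$. **Minimal counts.** For $x\in[\mathbb F,\mathbb F]$ let $\operatorname{genus}(x)$ be the least $g\ge 0$ for which $x$ has a genus $g$ representation; a genus $g$ representation of $x$ is *minimal* if $g=\operatorname{genus}(x)$. Let $\hat n_{\mathbb F}(x)$ be the number of $\sim$-classes of minimal $\sim$-injective representations of $x$, let $\hat n'_{\mathbb F}(x)$ be the number of distinct images of minimal admissible representations of $x$, and put (with values in $\mathbb N\cup\{\infty\}$) $$\hat f_{\mathbb F}(g)=\sup\{\hat n_{\mathbb F}(x): x\in[\mathbb F,\mathbb F],\ \operatorname{genus}(x)=g\},\qquad \hat f'_{\mathbb F}(g)=\sup\{\hat n'_{\mathbb F}(x): x\in[\mathbb F,\mathbb F],\ \operatorname{genus}(x)=g\}.$$ **$\alpha$-maps.** For a homomorphism $\phi:\mathbb F_1\to\mathbb F_2$ let $m(\phi)=\min_{u\in\mathcal B_1}|\phi(u)|$, where elements of $\mathbb F_2$ are identified with reduced $\mathcal B_2$-words and $|\cdot|$ is word length. For $\alpha>0$,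 $\phi$ is an *$\alpha$-map* if (i) for each $u\in\mathcal B_1$, every subword of $\phi(u)$ of length $\ge\alpha\, m(\phi)$ occurs exactly once as a subword of $\phi(u)$; and (ii) for $u,v\in\mathcal B_1\sqcup\mathcal B_1^{-1}$, if $\phi(u)$ and $\phi(v)$ have a common subword of length $\ge\alpha\, m(\phi)$, then $u=v$. (Subwords may be empty.) **Corollary.** Given $x\in[\mathbb F_1,\mathbb F_1]$ there is $\alpha>0$ such that, for every $\mathbb F_2$ with finite basis $\mathcal B_2$ and every $\alpha$-map $\phi:\mathbb F_1\to\mathbb F_2$, $$\hat n'_{\mathbb F_2}(\phi(x))\ge\hat n'_{\mathbb F_1}(x)\qquad\text{and}\qquad \hat n_{\mathbb F_2}(\phi(x))\ge\hat n_{\mathbb F_1}(x).$$ Moreover $\hat f'_{\mathbb F}(g)$ and $\hat f_{\mathbb F}(g)$ do not depend on $\mathbb F$: for every $g\ge0$ and all $\mathbb F_1,\mathbb F_2$, $\hat f'_{\mathbb F_1}(g)=\hat f'_{\mathbb F_2}(g)$ and $\hat f_{\mathbb F_1}(g)=\hat f_{\mathbb F_2}(g)$. -/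

import Mathlib

/-- The free group `H_g = ⟨a₁, b₁, …, a_g, b_g⟩` of rank `2g`; the generator `a_i` is
`(i, false)` and `b_i` is `(i, true)`. -/
abbrev SurfaceGroup (g : ℕ) : Type := FreeGroup (Fin g × Bool)

/-- The boundary element `∂_g = [a₁, b₁] ⋯ [a_g, b_g]`, where `[a, b] = a b a⁻¹ b⁻¹`. -/
def surfaceBoundary (g : ℕ) : SurfaceGroup g :=
  (List.ofFn fun i : Fin g =>
    FreeGroup.of (i, false) * FreeGroup.of (i, true) *
      (FreeGroup.of (i, false))⁻¹ * (FreeGroup.of (i, true))⁻¹).prod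

/-- Genus `g` representations of `x`: homomorphisms `H_g → G` taking `∂_g` to `x`. -/
def GenusRep {G : Type*} [Group G] (g : ℕ) (x : G) : Type _ :=
  {h : SurfaceGroup g →* G // h (surfaceBoundary g) = x}

/-- The canonical homomorphism to `H` from the amalgamated product of two subgroups
`S 0`, `S 1` of `H` over a common subgroup `C`. -/
noncomputable def amalgamToGroup {H : Type*} [Group H] (S : Fin 2 → Subgroup H)
    (C : Subgroup H) (hC : ∀ i, C ≤ S i) :
    Monoid.PushoutI (fun i => Subgroup.inclusion (hC i)) →* H :=
  Monoid.PushoutI.lift (fun i => (S i).subtype) C.subtype (fun _ => rfl)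

/-- `H = A *_C B` as an internal decomposition into subgroups `A = S 0` and `B = S 1`
with a common subgroup `C`. -/
def IsAmalgam {H : Type*} [Group H] (S : Fin 2 → Subgroup H) (C : Subgroup H) : Prop :=
  ∃ hC : ∀ i, C ≤ S i, Function.Bijective (amalgamToGroup S C hC)

/-- `H = A *_φ = ⟨A, t ∣ t⁻¹ c t = φ(c), c ∈ C⟩`, where `A` is a subgroup of `H`, `t ∈ H`
and `φ : C ≃ C'` is an isomorphism between subgroups of `A`.  Since the stable letter `t` of
`HNNExtension A K L ψ` satisfies `t k t⁻¹ = ψ k` for `k ∈ K`, this is the HNN extension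
with `K = C'`, `L = C` and `ψ = φ⁻¹`. -/
def IsHNN {H : Type*} [Group H] (A : Subgroup H) (C C' : Subgroup A) (φ : C ≃* C')
    (t : H) : Prop :=
  ∃ ht : ∀ c : C', t * A.subtype (c : A) = A.subtype (φ.symm c : A) * t,
    Function.Bijective (HNNExtension.lift (A := C') (B := C) (φ := φ.symm) A.subtype t ht)

/-- Two genus `g` representations of `x` are related by a fractional Dehn twist. -/
def FractionalDehnTwist {G : Type*} [Group G] {g : ℕ} {x : G} (h h' : GenusRep g x) : Prop :=
  (∃ (S : Fin 2 → Subgroup (SurfaceGroup g)) (C : Subgroup (SurfaceGroup g)),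
      IsAmalgam S C ∧ IsCyclic C ∧ surfaceBoundary g ∈ S 0 ∧
      ∃ z : G, (∀ c ∈ C, z * h.1 c = h.1 c * z) ∧
        (∀ a ∈ S 0, h'.1 a = h.1 a) ∧ ∀ b ∈ S 1, h'.1 b = z * h.1 b * z⁻¹) ∨
  (∃ (A : Subgroup (SurfaceGroup g)) (C C' : Subgroup A) (φ : C ≃* C') (t : SurfaceGroup g),
      IsHNN A C C' φ t ∧ IsCyclic C ∧ surfaceBoundary g ∈ A ∧
      ∃ z : G, (∀ c ∈ C, z * h.1 (c : SurfaceGroup g) = h.1 (c : SurfaceGroup g) * z) ∧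
        (∀ a ∈ A, h'.1 a = h.1 a) ∧ h'.1 t = z * h.1 t)

/-- The equivalence relation `∼` generated by fractional Dehn twists. -/
def twistSetoid {G : Type*} [Group G] (g : ℕ) (x : G) : Setoid (GenusRep g x) :=
  Relation.EqvGen.setoid FractionalDehnTwist

/-- A representation is `∼`-injective if all equivalent representations are injective. -/
def IsTwistInjective {G : Type*} [Group G] {g : ℕ} {x : G} (h : GenusRep g x) : Prop :=
  ∀ h' : GenusRep g x, twistSetoid g x h h' → Function.Injective h'.1

/-- A subgroup is primitive if it is closed under taking roots. -/
def IsPrimitiveSubgroup {G : Type*} [Group G] (S : Subgroup G) : Prop :=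
  ∀ (y : G) (n : ℕ), n ≠ 0 → y ^ n ∈ S → y ∈ S

/-- A representation is admissible if it is injective with primitive image. -/
def IsAdmissible {G : Type*} [Group G] {g : ℕ} {x : G} (h : GenusRep g x) : Prop :=
  Function.Injective h.1 ∧ IsPrimitiveSubgroup h.1.range

/-- The number of `∼`-classes of `∼`-injective genus `g` representations of `x`. -/
noncomputable def numClasses {G : Type*} [Group G] (g : ℕ) (x : G) : ℕ∞ :=
  {q : Quotient (twistSetoid g x) |
    ∃ h : GenusRep g x, IsTwistInjective h ∧ Quotient.mk _ h = q}.encard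

/-- The number of images of admissible genus `g` representations of `x`. -/
noncomputable def numImages {G : Type*} [Group G] (g : ℕ) (x : G) : ℕ∞ :=
  {S : Subgroup G | ∃ h : GenusRep g x, IsAdmissible h ∧ h.1.range = S}.encard

/-- The algebraic genus of `x` (meaningful for `x` in the commutator subgroup): the smallest
`g ≥ 0` such that `x` has a genus `g` representation. -/
noncomputable def algGenus {G : Type*} [Group G] (x : G) : ℕ :=
  sInf {g : ℕ | Nonempty (GenusRep g x)}

/-- The number of `∼`-classes of minimal `∼`-injective representations of `x`. -/
noncomputable def minNumClasses {G : Type*} [Group G] (x : G) : ℕ∞ :=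
  numClasses (algGenus x) x

/-- The number of images of minimal admissible representations of `x`. -/
noncomputable def minNumImages {G : Type*} [Group G] (x : G) : ℕ∞ :=
  numImages (algGenus x) x

/-- `f̂_G(g)`: the supremum of the number of `∼`-classes of minimal `∼`-injective
representations, over the elements of `[G, G]` of algebraic genus `g`. -/
noncomputable def fHat (G : Type*) [Group G] (g : ℕ) : ℕ∞ :=
  ⨆ (x : G) (_ : x ∈ commutator G ∧ algGenus x = g), minNumClasses x

/-- `f̂'_G(g)`: the supremum of the number of images of minimal admissible
representations, over the elements of `[G, G]` of algebraic genus `g`. -/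
noncomputable def fHatPrime (G : Type*) [Group G] (g : ℕ) : ℕ∞ :=
  ⨆ (x : G) (_ : x ∈ commutator G ∧ algGenus x = g), minNumImages x

open Classical in
/-- The reduced word in the basis `b` and its inverses that represents `x`. -/
noncomputable def basisWord {ι F : Type*} [Group F] (b : FreeGroupBasis ι F) (x : F) :
    List (ι × Bool) :=
  (b.repr x).toWord

/-- The element of `F` given by a letter of `𝓑^{±1}`; `(i, true)` is the basis element `b i`
and `(i, false)` is its inverse. -/
def signedBasis {ι F : Type*} [Group F] (b : FreeGroupBasis ι F) (u : ι × Bool) : F :=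
  if u.2 then b u.1 else (b u.1)⁻¹

/-- `m(φ)`: the minimal length of the images of the basis elements. -/
noncomputable def minImageLength {ι₁ F₁ ι₂ F₂ : Type*} [Group F₁] [Group F₂]
    (b₁ : FreeGroupBasis ι₁ F₁) (b₂ : FreeGroupBasis ι₂ F₂) (φ : F₁ →* F₂) : ℕ :=
  ⨅ i : ι₁, (basisWord b₂ (φ (b₁ i))).length

/-- `φ` is an `α`-map with respect to the bases `b₁` and `b₂`: a subword of length at least
`α m(φ)` of the image of a basis element appears in it only once, and the images of two
different elements of `𝓑₁^{±1}` have no common subword of length at least `α m(φ)`. -/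
def IsAlphaMap {ι₁ F₁ ι₂ F₂ : Type*} [Group F₁] [Group F₂]
    (b₁ : FreeGroupBasis ι₁ F₁) (b₂ : FreeGroupBasis ι₂ F₂) (α : ℝ) (φ : F₁ →* F₂) : Prop :=
  (∀ (i : ι₁) (w s t s' t' : List (ι₂ × Bool)),
      α * (minImageLength b₁ b₂ φ : ℝ) ≤ (w.length : ℝ) →
      basisWord b₂ (φ (b₁ i)) = s ++ w ++ t →
      basisWord b₂ (φ (b₁ i)) = s' ++ w ++ t' →
      s = s' ∧ t = t') ∧
  (∀ (u v : ι₁ × Bool) (w : List (ι₂ × Bool)),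
      α * (minImageLength b₁ b₂ φ : ℝ) ≤ (w.length : ℝ) →
      w <:+: basisWord b₂ (φ (signedBasis b₁ u)) →
      w <:+: basisWord b₂ (φ (signedBasis b₁ v)) →
      u = v)

/-! For small α, an α-map φ is a small-cancellation embedding. The images of different letters share
no long subword (`IsAlphaMap.isSeparated`), so little cancels in a product, and a marker subword
found in a reduced word φ(u) reveals the letter of u it comes from. This makes φ injective. Shifting
a marker by one period inside the word of a power shows that φ(F₁) is closed under roots
(`IsSeparated.mem_range_of_pow_mem_range`).

Composition with φ turns representations of x into representations of φ(x), and admissible ones stay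
admissible. For twist classes the danger is a twist of φ ∘ h by an element z outside φ(F₁). Now z
centralizes φ(h(C)); if h is injective and C ≠ 1, root closure puts z into φ(F₁), so the twist
descends to F₁ (`FractionalDehnTwist.exists_of_map`). If C = 1 then z is arbitrary, but ∂_g lies in
no proper free factor of H_g, so such a splitting does nothing. Indeed an endomorphism fixing ∂_g
respects the symplectic form on rational cohomology, which representations in the Heisenberg group
detect, and so it is injective there (`rationalPullback_injective`).

Only minimal representations count, so the genus of x must not drop. Here α depends on x: a
Brooks-type map ρ from F₂ back to F₁, a noncommutative count of marker words, inverts φ on letters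
and is multiplicative on finitely many prescribed products (`IsSeparated.exists_local_retraction`).
Applied to an expression of φ(x) by g commutators, it gives one of x.

Finally, α-maps exist for every α > 0 (`exists_isAlphaMap`), so the suprema bound each other in both
directions. -/

open FreeGroup hiding map_mul map_one map_inv

/-- Reduced words `A s`, one for each signed letter `s`, such that a word with more than `ℓ`
letters occurs at most once in all of them, and all of them are longer than `K * ℓ`. -/
structure IsSeparated {α β : Type*} (A : α × Bool → List (β × Bool)) (ℓ K : ℕ) : Prop where
  inv : ∀ i, A (i, false) = invRev (A (i, true))
  reduced : ∀ s, IsReduced (A s)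
  long : ∀ s, K * ℓ < (A s).length
  unique : ∀ s s' x w z x' z', ℓ < w.length → A s = x ++ w ++ z → A s' = x' ++ w ++ z' →
    s = s' ∧ x = x'

/-! ### Noncommutative counting of subwords -/

section WindowProd

variable {X G : Type*} [Group G]

/-- The product, from left to right, of the values of `lam` on the subwords of length `L`. -/
def windowProd (L : ℕ) (lam : List X → G) : List X → G
  | [] => 1
  | a :: t => lam ((a :: t).take L) * windowProd L lam t

theorem windowProd_append {L : ℕ} {lam : List X → G} (hlam : ∀ w, lam w ≠ 1 → w.length = L)
    (u v : List X)
    (hj : ∀ s t, s <:+ u → t <+: v → s ≠ [] → t ≠ [] → lam (s ++ t) = 1) :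
    windowProd L lam (u ++ v) = windowProd L lam u * windowProd L lam v := by
  induction u with
  | nil => simp [windowProd]
  | cons a u ih =>
    rw [List.cons_append, windowProd, windowProd,
      ih fun s t hs ht => hj s t (hs.trans (List.suffix_cons a u)) ht, mul_assoc]
    congr 1
    rw [← List.cons_append, List.take_append]
    rcases le_or_gt L (a :: u).length with h | h
    · rw [Nat.sub_eq_zero_of_le h, List.take_zero, List.append_nil]
    · rw [List.take_of_length_le h.le]
      by_cases hv : v.take (L - (a :: u).length) = []
      · rw [hv, List.append_nil]
      · rw [hj _ _ List.suffix_rfl (List.take_prefix _ _) (by simp) hv]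
        by_contra hne
        exact h.ne (hlam _ (Ne.symm hne))

theorem windowProd_eq_one {L : ℕ} {lam : List X → G} (u : List X)
    (h : ∀ t, t <:+ u → lam (t.take L) = 1) : windowProd L lam u = 1 := by
  induction u with
  | nil => rfl
  | cons a u ih =>
    rw [windowProd, h _ List.suffix_rfl, ih fun t ht => h t (ht.trans (List.suffix_cons a u)),
      one_mul]

theorem windowProd_eq_of_unique {L : ℕ} {lam : List X → G} (x w z : List X) (hw : w.length = L)
    (hL : 0 < L) (h : ∀ t, t <:+ x ++ w ++ z → lam (t.take L) ≠ 1 → t = w ++ z) :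
    windowProd L lam (x ++ w ++ z) = lam w := by
  induction x with
  | nil =>
    obtain _ | ⟨a, w⟩ := w
    · simp at hw; omega
    rw [List.nil_append, List.cons_append, windowProd, windowProd_eq_one, mul_one,
      ← List.cons_append, List.take_append_of_le_length hw.ge, List.take_of_length_le hw.le]
    intro t ht
    by_contra hne
    have h1 := h t (ht.trans (by simp)) hne
    have h2 := ht.length_le
    rw [h1] at h2
    simp at h2
  | cons a x ih =>
    rw [List.cons_append, List.cons_append, windowProd, ih, mul_eq_right]
    · by_contra hne
      have h1 := h _ (by simp) hne
      have := congrArg List.length h1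
      simp at this
      omega
    · intro t ht
      exact h t (ht.trans (by simp))

/-- Inversion reverses a word, so windows listed by their first letter must also be listed by their
last. -/
theorem windowProd_concat {L : ℕ} {lam : List X → G} (hlam : ∀ w, lam w ≠ 1 → w.length = L)
    (hL : 0 < L) (u : List X) (a : X) :
    windowProd L lam (u ++ [a]) =
      windowProd L lam u * lam ((u ++ [a]).drop ((u ++ [a]).length - L)) := by
  have hs : ∀ w : List X, w.length ≠ L → lam w = 1 := fun w hw => by
    by_contra h; exact hw (hlam w h)
  induction u with
  | nil =>
    have h1 : [a].take L = [a] := List.take_of_length_le hL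
    have h2 : [a].drop ([a].length - L) = [a] := by
      rw [show [a].length - L = 0 from Nat.sub_eq_zero_of_le hL, List.drop_zero]
    simp only [List.nil_append, windowProd, h1, h2, mul_one, one_mul]
  | cons b u ih =>
    rw [List.cons_append, windowProd, windowProd, ih, mul_assoc]
    rcases lt_trichotomy (u.length + 2) L with h | h | h
    · have h1 : ∀ w : List X, w.length ≤ u.length + 2 → lam w = 1 := fun w hw => hs w (by omega)
      rw [h1 _ (by simp), h1 ((b :: u).take L) (by simp), h1 _ (by simp; omega), h1 _ (by simp)]
    · have e1 : (b :: (u ++ [a])).take L = b :: (u ++ [a]) :=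
        List.take_of_length_le (by simp; omega)
      have e2 : (b :: (u ++ [a])).drop ((b :: (u ++ [a])).length - L) = b :: (u ++ [a]) := by
        rw [Nat.sub_eq_zero_of_le (by simp; omega), List.drop_zero]
      rw [e1, e2, hs ((b :: u).take L) (by simp; omega), hs ((u ++ [a]).drop _) (by simp; omega),
        windowProd_eq_one u]
      · simp
      · intro t ht
        have := ht.length_le
        exact hs _ (by simp; omega)
    · have e1 : (b :: (u ++ [a])).take L = (b :: u).take L := by
        rw [← List.cons_append, List.take_append_of_le_length (by simp; omega)]
      have e2 : (b :: (u ++ [a])).drop ((b :: (u ++ [a])).length - L) =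
          (u ++ [a]).drop ((u ++ [a]).length - L) := by
        have : (b :: (u ++ [a])).length - L = ((u ++ [a]).length - L) + 1 := by simp; omega
        rw [this, List.drop_succ_cons]
      rw [e1, e2]

end WindowProd

theorem windowProd_invRev {β G : Type*} [Group G] {L : ℕ} {lam : List (β × Bool) → G}
    (hlam : ∀ w, lam w ≠ 1 → w.length = L) (hL : 0 < L)
    (hinv : ∀ w, lam (invRev w) = (lam w)⁻¹) (u : List (β × Bool)) :
    windowProd L lam (invRev u) = (windowProd L lam u)⁻¹ := by
  induction u with
  | nil => simp [windowProd]
  | cons a u ih =>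
    have h1 : invRev (a :: u) = invRev u ++ [(a.1, !a.2)] := by simp [invRev]
    rw [windowProd, mul_inv_rev, ← ih, ← hinv, h1, windowProd_concat hlam hL, ← h1]
    congr 2
    simp [invRev, List.map_take, List.reverse_take]

/-! ### Cancellation in products and subwords across a cut -/

theorem exists_cancellation {β : Type*} (u v : List (β × Bool)) (hu : IsReduced u)
    (hv : IsReduced v) :
    ∃ p c q, u = p ++ c ∧ v = invRev c ++ q ∧ IsReduced (p ++ q) := by
  induction u using List.reverseRecOn generalizing v with
  | nil => exact ⟨[], [], v, rfl, rfl, hv⟩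
  | append_singleton u a ih =>
    obtain _ | ⟨b, v⟩ := v
    · exact ⟨u ++ [a], [], [], by simp, rfl, by simpa using hu⟩
    by_cases h : a.1 = b.1 → a.2 = b.2
    · refine ⟨u ++ [a], [], b :: v, by simp, rfl, ?_⟩
      have := IsReduced.append_overlap (L₁ := u) (L₂ := [a]) (L₃ := b :: v) hu
        (by simpa using ⟨h, hv⟩) (by simp)
      simpa using this
    · push Not at h
      obtain ⟨p, c, q, h1, h2, h3⟩ := ih v (hu.infix ⟨[], [a], rfl⟩)
        (hv.infix ⟨[b], [], by simp⟩)
      refine ⟨p, c ++ [a], q, by simp [h1], ?_, h3⟩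
      have hb : b = (a.1, !a.2) := by
        ext
        · exact h.1.symm
        · have := h.2
          revert this
          cases a.2 <;> cases b.2 <;> simp
      simp [invRev_append, h2, hb]
      simp [invRev]

theorem exists_toWord_mul {β : Type*} [DecidableEq β] (x y : FreeGroup β) :
    ∃ p c q, x.toWord = p ++ c ∧ y.toWord = invRev c ++ q ∧ (x * y).toWord = p ++ q := by
  obtain ⟨p, c, q, h1, h2, h3⟩ := exists_cancellation x.toWord y.toWord isReduced_toWord
    isReduced_toWord
  refine ⟨p, c, q, h1, h2, ?_⟩
  rw [← h3.reduce_eq, ← toWord_mk]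
  congr 1
  rw [← mk_toWord (x := x), ← mk_toWord (x := y), h1, h2, ← mul_mk, ← mul_mk, ← mul_mk, ← inv_mk]
  group

/-- The words of length `ℓ + 1` that consist of a nonempty final part of `u` and a nonempty initial
part of `v`. -/
def junctionWords {X : Type*} [DecidableEq X] (ℓ : ℕ) (j : List X × List X) : Finset (List X) :=
  (Finset.range ℓ).image fun i => j.1.drop (j.1.length - (i + 1)) ++ j.2.take (ℓ - i)

theorem mem_junctionWords {X : Type*} [DecidableEq X] {ℓ : ℕ} {u v s t : List X} (hs : s <:+ u)
    (ht : t <+: v) (hs0 : s ≠ []) (ht0 : t ≠ []) (hl : (s ++ t).length = ℓ + 1) :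
    s ++ t ∈ junctionWords ℓ (u, v) := by
  have h1 := List.length_pos_iff.2 hs0
  have h2 := List.length_pos_iff.2 ht0
  rw [List.length_append] at hl
  refine Finset.mem_image.2 ⟨s.length - 1, by simp; omega, ?_⟩
  have e1 := List.suffix_iff_eq_drop.1 hs
  have e2 := List.prefix_iff_eq_take.1 ht
  conv_rhs => rw [e1, e2]
  congr 2
  · simp only []; congr 1; omega
  · omega

theorem card_junctionWords_le {X : Type*} [DecidableEq X] (ℓ : ℕ) (j : List X × List X) :
    (junctionWords ℓ j).card ≤ ℓ :=
  Finset.card_image_le.trans (by simp)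

/-! ### Local retractions -/

namespace IsSeparated

variable {α β G : Type*} [Group G] {A : α × Bool → List (β × Bool)} {ℓ K : ℕ}

theorem inv' (hA : IsSeparated A ℓ K) (s : α × Bool) : A (s.1, !s.2) = invRev (A s) := by
  obtain ⟨i, _ | _⟩ := s
  · simp [hA.inv i]
  · exact hA.inv i

/-- Pigeonhole: the `(A s).length - ℓ` windows of length ℓ + 1 are pairwise different by separation.
-/
theorem exists_window [DecidableEq β] (hA : IsSeparated A ℓ K) (s : α × Bool)
    (B : Finset (List (β × Bool))) (hB : B.card + ℓ < (A s).length) :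
    ∃ x w z, A s = x ++ w ++ z ∧ w.length = ℓ + 1 ∧ w ∉ B := by
  classical
  set f : ℕ → List (β × Bool) := fun p => ((A s).drop p).take (ℓ + 1) with hf
  have hdec : ∀ p, A s = (A s).take p ++ f p ++ ((A s).drop p).drop (ℓ + 1) := by
    intro p
    rw [List.append_assoc, List.take_append_drop, List.take_append_drop]
  have hlen : ∀ p ∈ Finset.range ((A s).length - ℓ), (f p).length = ℓ + 1 := by
    intro p hp
    simp only [Finset.mem_range] at hp
    simp [hf]; omega
  have hinj : Set.InjOn f (Finset.range ((A s).length - ℓ)) := by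
    intro p hp q hq hpq
    have h1 := hlen p hp
    have h2 := (hA.unique s s _ _ _ _ _ (by omega) (hdec p) (hpq ▸ hdec q)).2
    have h3 := congrArg List.length h2
    simp only [Finset.coe_range, Set.mem_Iio] at hp hq
    simp at h3
    omega
  obtain ⟨w, hw, hwB⟩ := Finset.exists_mem_notMem_of_card_lt_card
    (s := B) (t := (Finset.range ((A s).length - ℓ)).image f) (by
      rw [Finset.card_image_of_injOn hinj, Finset.card_range]; omega)
  obtain ⟨p, hp, rfl⟩ := Finset.mem_image.1 hw
  exact ⟨_, _, _, hdec p, hlen p hp, hwB⟩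

/-- A map to `G` with prescribed values on the `A s` that respects inverses and finitely many
given products. -/
theorem exists_local_retraction [DecidableEq β] (hA : IsSeparated A ℓ K) (f : α → G)
    (js : List (FreeGroup β × FreeGroup β)) (hK : 6 * js.length + 1 ≤ K) :
    ∃ ρ : FreeGroup β → G, ρ 1 = 1 ∧ (∀ x, ρ x⁻¹ = (ρ x)⁻¹) ∧
      (∀ i, ρ (FreeGroup.mk (A (i, true))) = f i) ∧ ∀ p ∈ js, ρ (p.1 * p.2) = ρ p.1 * ρ p.2 := by
  classical
  choose p c q hp hq hpq using fun j : FreeGroup β × FreeGroup β => exists_toWord_mul j.1 j.2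
  -- With x = pc, y = c⁻¹q and xy = pq, multiplicativity of ρ at (x, y) can fail only through
  -- markers across one of these three cuts.
  let bad (j : FreeGroup β × FreeGroup β) : Finset (List (β × Bool)) :=
    junctionWords ℓ (p j, c j) ∪ junctionWords ℓ (invRev (c j), q j) ∪ junctionWords ℓ (p j, q j)
  have hbad : ∀ j, (bad j).card ≤ 3 * ℓ := by
    intro j
    have h1 := card_junctionWords_le ℓ (p j, c j)
    have h2 := card_junctionWords_le ℓ (invRev (c j), q j)
    have h3 := card_junctionWords_le ℓ (p j, q j)
    have h4 := Finset.card_union_le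
      (junctionWords ℓ (p j, c j) ∪ junctionWords ℓ (invRev (c j), q j)) (junctionWords ℓ (p j, q j))
    have h5 := Finset.card_union_le (junctionWords ℓ (p j, c j))
      (junctionWords ℓ (invRev (c j), q j))
    simp only [bad]
    omega
  let B₀ := js.toFinset.biUnion bad
  have hB₀ : B₀.card ≤ js.length * (3 * ℓ) :=
    (Finset.card_biUnion_le_card_mul _ _ _ fun j _ => hbad j).trans
      (Nat.mul_le_mul_right _ js.toFinset_card_le)
  -- The inverses of the markers must avoid `B₀` too; this doubles the count 3ℓ per product and
  -- explains the 6 in the bound.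
  let B := B₀ ∪ B₀.image invRev
  have hB : B.card ≤ 2 * (js.length * (3 * ℓ)) := by
    have := Finset.card_union_le B₀ (B₀.image invRev)
    have := Finset.card_image_le (s := B₀) (f := invRev)
    simp only [B]
    omega
  have hcard : ∀ i, B.card + ℓ < (A (i, true)).length := by
    intro i
    refine lt_of_le_of_lt ?_ (hA.long (i, true))
    calc B.card + ℓ ≤ 2 * (js.length * (3 * ℓ)) + ℓ := by omega
      _ = (6 * js.length + 1) * ℓ := by ring
      _ ≤ K * ℓ := Nat.mul_le_mul_right _ hK
  choose x w z hw hwl hwB using fun i => hA.exists_window (i, true) B (hcard i)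
  let W : α × Bool → List (β × Bool) := fun s => if s.2 then w s.1 else invRev (w s.1)
  have hWl : ∀ s, (W s).length = ℓ + 1 := by
    rintro ⟨i, _ | _⟩ <;> simp [W, hwl]
  have hWB : ∀ s, W s ∉ B₀ := by
    rintro ⟨i, _ | _⟩ h
    · exact hwB i (Finset.mem_union_right _ (Finset.mem_image.2 ⟨_, h, by simp [W]⟩))
    · exact hwB i (Finset.mem_union_left _ h)
  have hWA : ∀ s, ∃ x z, A s = x ++ W s ++ z := by
    rintro ⟨i, _ | _⟩
    · refine ⟨invRev (z i), invRev (x i), ?_⟩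
      rw [hA.inv, hw i]
      simp [W]
    · exact ⟨x i, z i, hw i⟩
  have hWinj : Function.Injective W := by
    intro s s' hss
    obtain ⟨x, z, h⟩ := hWA s
    obtain ⟨x', z', h'⟩ := hWA s'
    rw [← hss] at h'
    exact (hA.unique s s' _ _ _ _ _ (by rw [hWl]; omega) h h').1
  have hWinv : ∀ s : α × Bool, W (s.1, !s.2) = invRev (W s) := by
    rintro ⟨i, _ | _⟩ <;> simp [W]
  let F : α × Bool → G := fun s => if s.2 then f s.1 else (f s.1)⁻¹
  have hFinv : ∀ s : α × Bool, F (s.1, !s.2) = (F s)⁻¹ := by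
    rintro ⟨i, _ | _⟩ <;> simp [F]
  let lam : List (β × Bool) → G := fun v => if h : ∃ s, W s = v then F h.choose else 1
  have hlamW : ∀ s, lam (W s) = F s := by
    intro s
    have h : ∃ s', W s' = W s := ⟨s, rfl⟩
    simp only [lam, dif_pos h]
    rw [hWinj h.choose_spec]
  have hlam1 : ∀ v, lam v ≠ 1 → ∃ s, W s = v := by
    intro v hv
    by_contra h
    exact hv (dif_neg h)
  have hlaml : ∀ v, lam v ≠ 1 → v.length = ℓ + 1 := by
    intro v hv
    obtain ⟨s, rfl⟩ := hlam1 v hv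
    exact hWl s
  have hlaminv : ∀ v, lam (invRev v) = (lam v)⁻¹ := by
    intro v
    by_cases h : ∃ s, W s = v
    · obtain ⟨s, rfl⟩ := h
      rw [← hWinv, hlamW, hlamW, hFinv]
    · have h' : ¬ ∃ s, W s = invRev v := by
        rintro ⟨s, hs⟩
        exact h ⟨(s.1, !s.2), by rw [hWinv, hs, invRev_invRev]⟩
      simp only [lam, dif_neg h, dif_neg h', inv_one]
  have hjunc : ∀ j ∈ js, ∀ u v, junctionWords ℓ (u, v) ⊆ bad j →
      windowProd (ℓ + 1) lam (u ++ v) = windowProd (ℓ + 1) lam u * windowProd (ℓ + 1) lam v := by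
    intro j hj u v hsub
    refine windowProd_append hlaml u v fun s t hs ht hs0 ht0 => ?_
    by_contra hne
    obtain ⟨r, hr⟩ := hlam1 _ hne
    refine hWB r (Finset.mem_biUnion.2 ⟨j, by simpa using hj, hsub ?_⟩)
    rw [hr]
    exact mem_junctionWords hs ht hs0 ht0 (hlaml _ hne)
  have hrev := windowProd_invRev hlaml (Nat.succ_pos ℓ) hlaminv
  refine ⟨fun y => windowProd (ℓ + 1) lam y.toWord, by simp [windowProd], fun y => ?_, fun i => ?_,
    fun j hj => ?_⟩
  · simp only [toWord_inv, hrev]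
  · simp only [toWord_mk, (hA.reduced _).reduce_eq]
    rw [hw i, windowProd_eq_of_unique _ _ _ (hwl i) (Nat.succ_pos ℓ)]
    · exact hlamW (i, true)
    -- By separation, the only marker inside `A (i, true)` is its own, and it occurs there once.
    · intro t ht hne
      obtain ⟨s, hs⟩ := hlam1 _ hne
      obtain ⟨x', z', hx'⟩ := hWA s
      obtain ⟨r, hr⟩ := ht
      rw [← List.take_append_drop (ℓ + 1) t, ← List.append_assoc, ← hs, ← hw i] at hr
      obtain ⟨h1, -⟩ := hA.unique s (i, true) _ _ _ _ _ (by rw [hWl]; omega) hx' hr.symm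
      subst h1
      obtain ⟨-, h2⟩ := hA.unique (i, true) (i, true) _ _ _ _ _ (by rw [hwl]; omega) (hw i)
        hr.symm
      rw [hs, ← h2, hw i] at hr
      rw [List.append_assoc, List.append_assoc] at hr
      rw [← List.append_cancel_left hr, List.take_append_drop]
  -- The values on c and on c⁻¹ cancel.
  · simp only [hp j, hq j, hpq j]
    rw [hjunc j hj _ _ (Finset.subset_union_right),
      hjunc j hj _ _ (Finset.subset_union_left.trans Finset.subset_union_left),
      hjunc j hj _ _ (Finset.subset_union_right.trans Finset.subset_union_left), hrev]
    group

end IsSeparated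

/-! ### Injectivity and root closure of the image -/

namespace IsSeparated

variable {α β : Type*} [DecidableEq β] {A : α × Bool → List (β × Bool)} {ℓ K : ℕ}
  {ψ : FreeGroup α →* FreeGroup β}

theorem toWord_mk_eq (hA : IsSeparated A ℓ K) (s : α × Bool) :
    (FreeGroup.mk (A s)).toWord = A s := by
  rw [toWord_mk, (hA.reduced s).reduce_eq]

/-- The basic cancellation estimate: attaching one more letter image cancels at most ℓ letters, so
each image keeps its long middle part. -/
theorem exists_toWord_concat (hA : IsSeparated A ℓ K) (hK : 5 ≤ K)
    (hψ : ∀ s, ψ (FreeGroup.mk [s]) = FreeGroup.mk (A s)) (U : List (α × Bool)) (s : α × Bool)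
    (hU : IsReduced (U ++ [s])) :
    ∃ p c q, (ψ (FreeGroup.mk U)).toWord = p ++ c ∧ A s = invRev c ++ q ∧
      (ψ (FreeGroup.mk (U ++ [s]))).toWord = p ++ q ∧ c.length ≤ ℓ := by
  induction U using List.reverseRecOn generalizing s with
  | nil =>
    refine ⟨[], [], A s, ?_, rfl, ?_, by simp⟩
    · rw [← one_eq_mk, map_one, toWord_one, List.nil_append]
    · rw [List.nil_append, hψ, hA.toWord_mk_eq, List.nil_append]
  | append_singleton U s₀ ih =>
    obtain ⟨p₀, c₀, q₀, -, h2, h3, h4⟩ := ih s₀ (hU.infix ⟨[], [s], by simp⟩)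
    obtain ⟨p, c, q, e1, e2, e3⟩ :=
      exists_toWord_mul (ψ (FreeGroup.mk (U ++ [s₀]))) (FreeGroup.mk (A s))
    rw [hA.toWord_mk_eq] at e2
    rw [← hψ, ← map_mul, mul_mk] at e3
    refine ⟨p, c, q, e1, e2, e3, ?_⟩
    -- Otherwise the last ℓ + 1 letters of `A s₀` would also end `A` of the inverse of `s`, which
    -- makes `s₀` that inverse, against reducedness.
    by_contra! hc
    have hq₀ : ℓ < q₀.length := by
      have h5 := hA.long s₀
      rw [h2, List.length_append, invRev_length] at h5
      have : 5 * ℓ ≤ K * ℓ := Nat.mul_le_mul_right _ hK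
      omega
    have hsuf : c.drop (c.length - (ℓ + 1)) = q₀.drop (q₀.length - (ℓ + 1)) := by
      have hd := congrArg (fun l => l.drop (l.length - (ℓ + 1))) (e1.symm.trans h3)
      simp only [List.length_append] at hd
      rwa [show p.length + c.length - (ℓ + 1) = p.length + (c.length - (ℓ + 1)) by omega,
        show p₀.length + q₀.length - (ℓ + 1) = p₀.length + (q₀.length - (ℓ + 1)) by omega,
        List.drop_length_add_append, List.drop_length_add_append] at hd
    have h6 : A s₀ = (invRev c₀ ++ q₀.take (q₀.length - (ℓ + 1))) ++
        q₀.drop (q₀.length - (ℓ + 1)) ++ [] := by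
      rw [List.append_nil, List.append_assoc, List.take_append_drop, h2]
    have h7 : A (s.1, !s.2) = (invRev q ++ c.take (c.length - (ℓ + 1))) ++
        q₀.drop (q₀.length - (ℓ + 1)) ++ [] := by
      rw [← hsuf, List.append_nil, List.append_assoc, List.take_append_drop, hA.inv', e2,
        invRev_append, invRev_invRev]
    obtain ⟨h8, -⟩ := hA.unique _ _ _ _ _ _ _ (by simp; omega) h6 h7
    have h9 : IsReduced [s₀, s] := hU.infix ⟨U, [], by simp⟩
    simp [h8] at h9

/-- Recognition of markers: the central piece `w` of `A s` can appear in an image only in its own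
place inside a copy of `A s`, so what precedes it is an image times `a`. -/
theorem exists_mk_eq_of_toWord_eq (hA : IsSeparated A ℓ K) (hK : 5 ≤ K)
    (hψ : ∀ s, ψ (FreeGroup.mk [s]) = FreeGroup.mk (A s)) (U : List (α × Bool))
    (hU : IsReduced U) {s : α × Bool} {a w c P Q : List (β × Bool)} (hs : A s = a ++ w ++ c)
    (hw : w.length = 2 * ℓ + 1) (ha : ℓ ≤ a.length) (hc : ℓ ≤ c.length)
    (hD : (ψ (FreeGroup.mk U)).toWord = P ++ w ++ Q) :
    ∃ v, FreeGroup.mk P = ψ v * FreeGroup.mk a := by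
  have hK5 : 5 * ℓ ≤ K * ℓ := Nat.mul_le_mul_right _ hK
  induction U using List.reverseRecOn generalizing Q with
  | nil =>
    rw [← one_eq_mk, map_one, toWord_one] at hD
    have := congrArg List.length hD
    simp at this
    omega
  | append_singleton U s₀ ih =>
    obtain ⟨p, d, q, h1, h2, h3, h4⟩ := hA.exists_toWord_concat hK hψ U s₀ hU
    rw [h3] at hD
    rcases List.append_eq_append_iff.1 hD with ⟨z, e1, e2⟩ | ⟨z, e1, e2⟩
    · rcases List.append_eq_append_iff.1 e1 with ⟨z', e3, e4⟩ | ⟨z', e3, e4⟩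
      · -- the end of `p` lies inside `w`
        by_cases hz : z' = []
        · subst hz
          simp only [List.append_nil, List.nil_append] at e3 e4
          subst e3 e4
          rw [e2, ← List.append_assoc] at h2
          obtain ⟨rfl, rfl⟩ := hA.unique _ _ _ _ _ _ _ (by omega) hs h2
          refine ⟨FreeGroup.mk U, ?_⟩
          rw [← mk_toWord (x := ψ _), h1, ← mul_mk, ← inv_mk, mul_inv_cancel_right]
        have hz' := List.length_pos_iff.2 hz
        by_cases hz0 : z = []
        · subst hz0
          rw [List.append_nil] at e4
          subst e4
          exact ih (hU.infix ⟨[], [s₀], by simp⟩) (Q := d) (by rw [h1, e3])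
        have hz0' := List.length_pos_iff.2 hz0
        -- Now `w` straddles the cut, and one of its two parts is longer than ℓ. Separation locates
        -- that part in `A s₀` or `A s₁`; then the margin `a` or `c`, together with the other
        -- nonempty part of `w`, would have to fit in the at most ℓ cancelled letters.
        have hwl : z'.length + z.length = 2 * ℓ + 1 := by rw [← hw, e4, List.length_append]
        rcases lt_or_ge ℓ z.length with hlt | hle
        · rw [e2, ← List.append_assoc] at h2
          rw [e4, ← List.append_assoc] at hs
          obtain ⟨-, h5⟩ := hA.unique _ _ _ _ _ _ _ hlt hs h2
          have := congrArg List.length h5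
          simp only [List.length_append, invRev_length] at this
          omega
        · obtain rfl | ⟨U₀, s₁, rfl⟩ := U.eq_nil_or_concat'
          · rw [← one_eq_mk, map_one, toWord_one] at h1
            have := congrArg List.length h1
            rw [e3] at this
            simp at this
            omega
          obtain ⟨p₀, d₀, q₀, -, f2, f3, f4⟩ := hA.exists_toWord_concat hK hψ U₀ s₁
            (hU.infix ⟨[], [s₀], by simp⟩)
          have hq₀ := hA.long s₁
          rw [f2, List.length_append, invRev_length] at hq₀
          rw [f3, e3, List.append_assoc, List.append_eq_append_iff] at h1
          rcases h1 with ⟨x, -, hx⟩ | ⟨x, -, hx⟩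
          · rw [hx, ← List.append_assoc, ← List.append_assoc] at f2
            rw [e4, List.append_assoc a, List.append_assoc z', ← List.append_assoc a] at hs
            obtain ⟨rfl, h5⟩ := hA.unique _ _ _ _ _ _ _ (by omega) hs f2
            rw [← h5] at f2
            have := congrArg List.length (hs.symm.trans f2)
            simp only [List.length_append] at this
            omega
          · have := congrArg List.length hx
            simp only [List.length_append] at this
            omega
      · rw [e4, List.append_assoc] at e2
        rw [e2, ← List.append_assoc, ← List.append_assoc] at h2
        obtain ⟨rfl, rfl⟩ := hA.unique _ _ _ _ _ _ _ (by omega) hs h2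
        refine ⟨FreeGroup.mk U, ?_⟩
        rw [← mk_toWord (x := ψ _), h1, ← mul_mk, e3, ← mul_mk, ← mul_mk, ← inv_mk]
        group
    · exact ih (hU.infix ⟨[], [s₀], by simp⟩) (Q := z ++ d) (by rw [h1, e1]; simp)

/-- Converse of recognition: cancellation at either end of `A s` stays within the margins `a` and
`c`, so the marker survives. -/
theorem exists_toWord_eq (hA : IsSeparated A ℓ K) (hK : 5 ≤ K)
    (hψ : ∀ s, ψ (FreeGroup.mk [s]) = FreeGroup.mk (A s)) (U₁ U₂ : List (α × Bool))
    {s : α × Bool} (hU : IsReduced (U₁ ++ [s] ++ U₂)) {a w c : List (β × Bool)}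
    (hs : A s = a ++ w ++ c) (ha : ℓ ≤ a.length) (hc : ℓ ≤ c.length) :
    ∃ P Q, (ψ (FreeGroup.mk (U₁ ++ [s] ++ U₂))).toWord = P ++ w ++ Q ∧
      FreeGroup.mk P = ψ (FreeGroup.mk U₁) * FreeGroup.mk a ∧ ℓ ≤ Q.length := by
  have hK5 : 5 * ℓ ≤ K * ℓ := Nat.mul_le_mul_right _ hK
  induction U₂ using List.reverseRecOn with
  | nil =>
    rw [List.append_nil] at hU ⊢
    obtain ⟨p, d, q, h1, h2, h3, h4⟩ := hA.exists_toWord_concat hK hψ U₁ s hU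
    rw [h2, List.append_assoc, List.append_eq_append_iff] at hs
    have key : ∃ x, a = invRev d ++ x ∧ q = x ++ (w ++ c) := by
      rcases hs with h | ⟨x, hx, hx'⟩
      · exact h
      · have := congrArg List.length hx
        rw [List.length_append, invRev_length] at this
        have hx0 : x = [] := List.length_eq_zero_iff.1 (by omega)
        subst hx0
        exact ⟨[], by simpa using hx.symm, by simpa using hx'.symm⟩
    obtain ⟨x, rfl, rfl⟩ := key
    refine ⟨p ++ x, c, by rw [h3]; simp, ?_, hc⟩
    rw [← mk_toWord (x := ψ _), h1, ← mul_mk, ← mul_mk, ← mul_mk, ← inv_mk]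
    group
  | append_singleton U₂ s' ih =>
    rw [← List.append_assoc] at hU ⊢
    obtain ⟨P, Q, e1, e2, e3⟩ := ih (hU.infix ⟨[], [s'], by simp⟩)
    obtain ⟨p, d, q, h1, h2, h3, h4⟩ := hA.exists_toWord_concat hK hψ _ s' hU
    have hq := hA.long s'
    rw [h2, List.length_append, invRev_length] at hq
    rw [e1, List.append_eq_append_iff] at h1
    have key : ∃ x, p = P ++ w ++ x := by
      rcases h1 with ⟨x, hx, -⟩ | ⟨x, hx, hx'⟩
      · exact ⟨x, hx⟩
      · have := congrArg List.length hx'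
        rw [List.length_append] at this
        have hx0 : x = [] := List.length_eq_zero_iff.1 (by omega)
        subst hx0
        exact ⟨[], by simpa using hx.symm⟩
    obtain ⟨x, rfl⟩ := key
    exact ⟨P, x ++ q, by rw [h3]; simp, e2, by simp; omega⟩

theorem injective (hA : IsSeparated A ℓ K) (hK : 5 ≤ K)
    (hψ : ∀ s, ψ (FreeGroup.mk [s]) = FreeGroup.mk (A s)) : Function.Injective ψ := by
  classical
  refine (injective_iff_map_eq_one ψ).2 fun y hy => ?_
  obtain h | ⟨U, s, h⟩ := y.toWord.eq_nil_or_concat'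
  · exact toWord_eq_nil_iff.1 h
  have hred : IsReduced (U ++ [s]) := h ▸ isReduced_toWord
  obtain ⟨p, c, q, -, h2, h3, h4⟩ := hA.exists_toWord_concat hK hψ U s hred
  rw [← h, mk_toWord, hy, toWord_one] at h3
  have h5 := hA.long s
  have h6 := congrArg List.length h3
  rw [h2] at h5
  simp only [List.length_append, invRev_length, List.length_nil] at h5 h6
  have : 5 * ℓ ≤ K * ℓ := Nat.mul_le_mul_right _ hK
  omega

theorem _root_.FreeGroup.toWord_pow_eq (y : FreeGroup β) {m : ℕ} (hm : m ≠ 0) :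
    (y ^ m).toWord = reduceCyclically.conjugator y.toWord ++
      (List.replicate m (reduceCyclically y.toWord)).flatten ++
        invRev (reduceCyclically.conjugator y.toWord) := by
  rw [toWord_pow, reduceCyclically.reduce_flatten_replicate isReduced_toWord, if_neg hm]

theorem _root_.FreeGroup.reduceCyclically_toWord_ne_nil {y : FreeGroup β} (hy : y ≠ 1) :
    reduceCyclically y.toWord ≠ [] := by
  intro h
  apply hy
  rw [← mk_toWord (x := y), ← reduceCyclically.conj_conjugator_reduceCyclically y.toWord, h,
    List.append_nil, ← mul_mk, ← inv_mk, mul_inv_cancel]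

theorem _root_.FreeGroup.le_norm_pow {y : FreeGroup β} (hy : y ≠ 1) (m : ℕ) :
    m ≤ (y ^ m).norm := by
  obtain rfl | hm := eq_or_ne m 0
  · simp
  have h := List.length_pos_iff.2 (reduceCyclically_toWord_ne_nil hy)
  rw [FreeGroup.norm, toWord_pow_eq y hm]
  simp only [List.length_append, List.length_flatten, List.map_replicate, List.sum_replicate,
    smul_eq_mul]
  nlinarith

/-- A high power of ψ(x) = yⁿ has the word k rᵐ k⁻¹, where r is the cyclic reduction of y. A marker
deep in the periodic part recurs one period r later in the next power. The text before it is thereby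
multiplied by y on the left, and by recognition both texts are images times the same `a`; hence y is
an image. -/
theorem mem_range_of_pow_mem_range [DecidableEq α] (hA : IsSeparated A ℓ K) (hK : 5 ≤ K)
    (hψ : ∀ s, ψ (FreeGroup.mk [s]) = FreeGroup.mk (A s)) {y : FreeGroup β} {n : ℕ} (hn : n ≠ 0)
    (hy : y ^ n ∈ ψ.range) : y ∈ ψ.range := by
  obtain ⟨x, hx⟩ := hy
  by_cases hy1 : y = 1
  · rw [hy1]; exact one_mem _
  have hx1 : x ≠ 1 := by
    rintro rfl
    rw [map_one] at hx
    exact hy1 ((pow_eq_one_iff.1 hx.symm).resolve_right hn)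
  set k' := reduceCyclically.conjugator x.toWord with hk'
  have hr' := reduceCyclically_toWord_ne_nil hx1
  set r' := reduceCyclically x.toWord with hrdef'
  obtain ⟨s, r'', hsr⟩ := List.exists_cons_of_ne_nil hr'
  have hxk : FreeGroup.mk k' * FreeGroup.mk r' = x * FreeGroup.mk k' := by
    conv_rhs => rw [← mk_toWord (x := x),
      ← reduceCyclically.conj_conjugator_reduceCyclically x.toWord, ← hk', ← hrdef',
      ← mul_mk, ← mul_mk, ← inv_mk]
    group
  have hxpow : ∀ i, FreeGroup.mk (k' ++ (List.replicate i r').flatten) = x ^ i * FreeGroup.mk k' := by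
    intro i
    induction i with
    | zero => simp
    | succ i ih =>
      rw [List.replicate_succ', List.flatten_append, ← List.append_assoc, ← mul_mk, ih, mul_assoc,
        List.flatten_singleton, hxk, pow_succ, mul_assoc]
  set k := reduceCyclically.conjugator y.toWord with hk
  set r := reduceCyclically y.toWord with hr
  obtain ⟨a, w, c, hs, hw, ha, hc⟩ : ∃ a w c, A s = a ++ w ++ c ∧ w.length = 2 * ℓ + 1 ∧
      ℓ ≤ a.length ∧ ℓ ≤ c.length := by
    have h1 := hA.long s
    have : 5 * ℓ ≤ K * ℓ := Nat.mul_le_mul_right _ hK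
    refine ⟨(A s).take ℓ, ((A s).drop ℓ).take (2 * ℓ + 1), ((A s).drop ℓ).drop (2 * ℓ + 1),
      ?_, ?_, ?_, ?_⟩
    · rw [List.append_assoc, List.take_append_drop, List.take_append_drop]
    all_goals simp; try omega
  set e := ψ (FreeGroup.mk k') * FreeGroup.mk a with he
  -- Since yᵐ has length at least m, these exponents force at least |k| letters on each side of the
  -- marker, so the conjugator is cleared.
  set i := e.norm + k.length with hi
  set j := e.norm + w.length + k.length with hj
  have hN : (x ^ (i + j + 1)).toWord = (k' ++ (List.replicate i r').flatten) ++ [s] ++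
      (r'' ++ (List.replicate j r').flatten ++ invRev k') := by
    have h : r' ++ (List.replicate j r').flatten = [s] ++ r'' ++ (List.replicate j r').flatten :=
      congrArg (· ++ (List.replicate j r').flatten) hsr
    rw [toWord_pow_eq x (by omega), add_assoc, List.replicate_add, List.replicate_succ, ← hk',
      ← hrdef', List.flatten_append, List.flatten_cons, h]
    simp
  obtain ⟨P, Q, hD, hP, -⟩ := hA.exists_toWord_eq hK hψ (k' ++ (List.replicate i r').flatten)
    (r'' ++ (List.replicate j r').flatten ++ invRev k') (hN ▸ isReduced_toWord) hs ha hc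
  rw [← hN, mk_toWord, map_pow, hx, ← pow_mul] at hD
  have hP' : FreeGroup.mk P = y ^ (n * i) * e := by
    rw [hP, hxpow, map_mul, map_pow, hx, he, pow_mul, mul_assoc]
  have hn1 : 1 ≤ n := Nat.one_le_iff_ne_zero.2 hn
  have hPl : k.length ≤ P.length := by
    have h1 : (FreeGroup.mk P).norm ≤ P.length := norm_mk_le
    have h2 := le_norm_pow hy1 (n * i)
    have h3 : y ^ (n * i) = FreeGroup.mk P * e⁻¹ := by rw [hP']; group
    have h4 := norm_mul_le (FreeGroup.mk P) e⁻¹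
    rw [← h3, norm_inv_eq] at h4
    have : 1 * i ≤ n * i := Nat.mul_le_mul_right _ hn1
    omega
  have hQl : k.length ≤ Q.length := by
    have h1 : (FreeGroup.mk (w ++ Q)).norm ≤ (w ++ Q).length := norm_mk_le
    have h2 := le_norm_pow hy1 (n * (j + 1))
    have h3 : y ^ (n * (j + 1)) = e * FreeGroup.mk (w ++ Q) := by
      have : y ^ (n * (i + j + 1)) = FreeGroup.mk P * FreeGroup.mk (w ++ Q) := by
        rw [← mk_toWord (x := y ^ _), hD, mul_mk, List.append_assoc]
      rw [hP', show n * (i + j + 1) = n * i + n * (j + 1) by ring, pow_add, mul_assoc] at this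
      exact mul_left_cancel this
    have h4 := norm_mul_le e (FreeGroup.mk (w ++ Q))
    rw [← h3] at h4
    rw [List.length_append] at h1
    have : 1 * (j + 1) ≤ n * (j + 1) := Nat.mul_le_mul_right _ hn1
    omega
  have hM : n * (i + j + 1) ≠ 0 := by positivity
  rw [toWord_pow_eq y hM, ← hk, ← hr, List.append_assoc, List.append_assoc] at hD
  obtain ⟨z, rfl⟩ : ∃ z, P = k ++ z :=
    (List.prefix_of_prefix_length_le ⟨_, hD⟩ ⟨_, rfl⟩ hPl).imp fun _ h => h.symm
  rw [List.append_assoc] at hD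
  have hD' := List.append_cancel_left hD
  obtain ⟨Q', rfl⟩ : ∃ Q', Q = Q' ++ invRev k := by
    have h1 : invRev k <:+ z ++ (w ++ Q) := ⟨_, hD'⟩
    have h2 : Q <:+ z ++ (w ++ Q) := ⟨z ++ w, by simp⟩
    exact (List.suffix_of_suffix_length_le h1 h2 (by simpa using hQl)).imp fun _ h => h.symm
  rw [← List.append_assoc, ← List.append_assoc] at hD'
  have hD'' := List.append_cancel_right hD'
  -- One further power of x supplies n more periods: one goes in front of the marker, the other n -
  -- 1 behind it.
  have hshift : (ψ (FreeGroup.mk (x ^ (i + j + 1 + 1)).toWord)).toWord =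
      (k ++ r ++ z) ++ w ++ (Q' ++ (List.replicate (n - 1) r).flatten ++ invRev k) := by
    rw [mk_toWord, map_pow, hx, ← pow_mul, toWord_pow_eq y (by positivity), ← hk, ← hr,
      show n * (i + j + 1 + 1) = 1 + (n * (i + j + 1) + (n - 1)) by
        rw [mul_add _ _ 1, mul_one]; omega,
      List.replicate_add, List.replicate_add, List.flatten_append, List.flatten_append, hD'']
    simp
  obtain ⟨v, hv⟩ := hA.exists_mk_eq_of_toWord_eq hK hψ _ isReduced_toWord hs hw ha hc hshift
  have hyk : FreeGroup.mk (k ++ r ++ z) = y * FreeGroup.mk (k ++ z) := by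
    conv_rhs => rw [← mk_toWord (x := y),
      ← reduceCyclically.conj_conjugator_reduceCyclically y.toWord, ← mul_mk, ← mul_mk, ← inv_mk]
    rw [← mul_mk, ← mul_mk, ← mul_mk, ← hk, ← hr]
    group
  rw [hyk, hP', he, ← mul_assoc, ← mul_assoc] at hv
  refine ⟨v * (x ^ i * FreeGroup.mk k')⁻¹, ?_⟩
  rw [map_mul, ← mul_right_cancel hv, map_inv, map_mul, map_pow, hx, pow_mul]
  group

end IsSeparated

/-! ### Centralizers in free groups -/

/-- The subgroup generated by z and c is free by Nielsen–Schreier and commutative, so it has at most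
one free generator. -/
theorem exists_zpow_eq_of_commute {G : Type*} [Group G] [IsFreeGroup G] {z c : G}
    (h : z * c = c * z) : ∃ (t : G) (m n : ℤ), z = t ^ m ∧ c = t ^ n := by
  let H : Subgroup G := Subgroup.closure {z, c}
  have hcomm : ∀ x y : H, x * y = y * x := by
    have : IsMulCommutative H := Subgroup.isMulCommutative_closure (by
      rintro x (rfl | rfl) y (rfl | rfl) <;> simp [h])
    exact fun x y => this.is_comm.comm x y
  let e := IsFreeGroup.mulEquiv H
  have hsub : ∀ i j : IsFreeGroup.Generators H, i = j := by
    classical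
    intro i j
    have h1 : FreeGroup.of i * FreeGroup.of j = FreeGroup.of j * FreeGroup.of i :=
      e.injective (by rw [map_mul, map_mul, hcomm])
    by_contra hij
    have h2 : IsReduced [(i, true), (j, true)] := by simp
    have h3 : IsReduced [(j, true), (i, true)] := by simp
    have h4 := congrArg toWord h1
    rw [FreeGroup.of, FreeGroup.of, mul_mk, mul_mk, toWord_mk, toWord_mk, List.cons_append,
      List.cons_append, List.nil_append, List.nil_append, h2.reduce_eq, h3.reduce_eq] at h4
    simp only [List.cons.injEq, Prod.mk.injEq] at h4
    exact hij h4.1.1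
  have key : ∃ t : H, ∀ x : H, ∃ m : ℤ, x = t ^ m := by
    by_cases hne : Nonempty (IsFreeGroup.Generators H)
    · obtain ⟨i⟩ := hne
      have : ∀ y : FreeGroup (IsFreeGroup.Generators H), y ∈ Subgroup.zpowers (FreeGroup.of i) := by
        intro y
        induction y using FreeGroup.induction_on with
        | C1 => exact one_mem _
        | of j => rw [hsub j i]; exact Subgroup.mem_zpowers _
        | inv_of j hj => exact inv_mem hj
        | mul x y hx hy => exact mul_mem hx hy
      refine ⟨e (FreeGroup.of i), fun x => ?_⟩
      obtain ⟨m, hm⟩ := this (e.symm x)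
      refine ⟨m, ?_⟩
      rw [← map_zpow]
      simp only at hm
      rw [hm, e.apply_symm_apply]
    · rw [not_nonempty_iff] at hne
      exact ⟨1, fun x => ⟨0, e.symm.injective (Subsingleton.elim _ _)⟩⟩
  obtain ⟨t, ht⟩ := key
  obtain ⟨m, hm⟩ := ht ⟨z, Subgroup.subset_closure (by simp)⟩
  obtain ⟨n, hn⟩ := ht ⟨c, Subgroup.subset_closure (by simp)⟩
  exact ⟨t, m, n, by simpa using congrArg Subtype.val hm, by simpa using congrArg Subtype.val hn⟩

theorem IsPrimitiveSubgroup.mem_of_commute {G : Type*} [Group G] [IsFreeGroup G]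
    {S : Subgroup G} (hS : IsPrimitiveSubgroup S) {z c : G} (hc : c ∈ S) (hc1 : c ≠ 1)
    (h : z * c = c * z) : z ∈ S := by
  obtain ⟨t, m, n, rfl, rfl⟩ := exists_zpow_eq_of_commute h
  have hn : n ≠ 0 := by
    rintro rfl
    simp at hc1
  have h1 : (t ^ m) ^ n ∈ S := by
    rw [← zpow_mul, mul_comm, zpow_mul]
    exact zpow_mem hc m
  refine hS _ n.natAbs (Int.natAbs_ne_zero.2 hn) ?_
  rcases Int.natAbs_eq n with h2 | h2
  · rw [h2, zpow_natCast] at h1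
    exact h1
  · rw [h2, zpow_neg, zpow_natCast] at h1
    exact inv_mem_iff.1 h1

/-! ### α-maps as separated families -/

section AlphaMap

variable {ι₁ F₁ ι₂ F₂ : Type*} [Group F₁] [Group F₂] {b₁ : FreeGroupBasis ι₁ F₁}
  {b₂ : FreeGroupBasis ι₂ F₂} {α : ℝ} {φ : F₁ →* F₂}

theorem basisWord_inv (b : FreeGroupBasis ι₁ F₁) (x : F₁) :
    basisWord b x⁻¹ = invRev (basisWord b x) := by
  classical
  rw [basisWord, map_inv, toWord_inv, basisWord]

theorem minImageLength_le (b₁ : FreeGroupBasis ι₁ F₁) (b₂ : FreeGroupBasis ι₂ F₂) (φ : F₁ →* F₂)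
    (s : ι₁ × Bool) :
    minImageLength b₁ b₂ φ ≤ (basisWord b₂ (φ (signedBasis b₁ s))).length := by
  have h : minImageLength b₁ b₂ φ ≤ (basisWord b₂ (φ (b₁ s.1))).length :=
    ciInf_le (OrderBot.bddBelow _) s.1
  obtain ⟨i, _ | _⟩ := s
  · simpa [signedBasis, basisWord_inv] using h
  · simpa [signedBasis] using h

/-- With ℓ = ⌈αm⌉ - 1, having more than ℓ letters means having length at least αm, while Kℓ < Kαm ≤
m when K > 0. -/
theorem IsAlphaMap.isSeparated [Nontrivial ι₁] (h : IsAlphaMap b₁ b₂ α φ) (hα : 0 < α) {K : ℕ}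
    (hK : α * K ≤ 1) :
    IsSeparated (fun s => basisWord b₂ (φ (signedBasis b₁ s)))
      (⌈α * minImageLength b₁ b₂ φ⌉₊ - 1) K := by
  classical
  set m := minImageLength b₁ b₂ φ with hm
  -- If m were 0, the empty word would be a forbidden common subword of the images of two basis
  -- elements.
  have hm0 : 0 < m := by
    rw [Nat.pos_iff_ne_zero]
    intro h0
    obtain ⟨i, j, hij⟩ := exists_pair_ne ι₁
    have := h.2 (i, true) (j, true) [] (by simp [← hm, h0]) (List.nil_infix) (List.nil_infix)
    exact hij (congrArg Prod.fst this)
  have hαm : 0 < α * m := mul_pos hα (by exact_mod_cast hm0)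
  have hceil : 0 < ⌈α * m⌉₊ := Nat.ceil_pos.2 hαm
  have hbig : ∀ w : List (ι₂ × Bool), ⌈α * m⌉₊ - 1 < w.length → α * m ≤ (w.length : ℝ) :=
    fun w hw => Nat.ceil_le.1 (by omega)
  refine ⟨fun i => ?_, fun s => ?_, fun s => ?_, fun s s' x w z x' z' hw h1 h2 => ?_⟩
  · simp [signedBasis, basisWord_inv]
  · exact isReduced_toWord
  · refine lt_of_lt_of_le ?_ (minImageLength_le b₁ b₂ φ s)
    rw [← hm]
    have h1 : ((⌈α * m⌉₊ - 1 : ℕ) : ℝ) < α * m := by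
      rw [Nat.cast_sub hceil, Nat.cast_one]
      linarith [Nat.ceil_lt_add_one hαm.le]
    have hK0 : (0 : ℝ) ≤ K := Nat.cast_nonneg K
    rcases Nat.eq_zero_or_pos K with rfl | hKpos
    · simpa using hm0
    have hK1 : (0 : ℝ) < K := by exact_mod_cast hKpos
    have h2 : (K : ℝ) * ((⌈α * m⌉₊ - 1 : ℕ) : ℝ) < m := by
      calc (K : ℝ) * ((⌈α * m⌉₊ - 1 : ℕ) : ℝ) < K * (α * m) := mul_lt_mul_of_pos_left h1 hK1
        _ = (α * K) * m := by ring
        _ ≤ 1 * m := mul_le_mul_of_nonneg_right hK (Nat.cast_nonneg m)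
        _ = m := one_mul _
    exact_mod_cast h2
  · obtain rfl : s = s' := h.2 s s' w (hbig w hw) ⟨x, z, h1.symm⟩ ⟨x', z', h2.symm⟩
    refine ⟨rfl, ?_⟩
    obtain ⟨i, _ | _⟩ := s
    · have hneg : basisWord b₂ (φ (signedBasis b₁ (i, false))) =
          invRev (basisWord b₂ (φ (b₁ i))) := by
        simp [signedBasis, basisWord_inv]
      rw [hneg] at h1 h2
      have h3 := congrArg invRev h1
      have h4 := congrArg invRev h2
      rw [invRev_invRev, invRev_append, invRev_append, ← List.append_assoc] at h3 h4
      have := (h.1 i _ _ _ _ _ (by rw [invRev_length]; exact hbig w hw) h3 h4).2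
      exact invRev_injective this
    · exact (h.1 i _ _ _ _ _ (hbig w hw) h1 h2).1

theorem repr_map_repr_symm_mk (b₁ : FreeGroupBasis ι₁ F₁) (b₂ : FreeGroupBasis ι₂ F₂)
    (φ : F₁ →* F₂) (s : ι₁ × Bool) :
    ((b₂.repr.toMonoidHom.comp φ).comp b₁.repr.symm.toMonoidHom) (FreeGroup.mk [s]) =
      FreeGroup.mk (basisWord b₂ (φ (signedBasis b₁ s))) := by
  classical
  rw [basisWord, mk_toWord]
  obtain ⟨i, _ | _⟩ := s
  · have : FreeGroup.mk [(i, false)] = (FreeGroup.of i)⁻¹ := rfl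
    have h2 : signedBasis b₁ (i, false) = (b₁ i)⁻¹ := by simp [signedBasis]
    rw [this, h2, map_inv, map_inv, map_inv]
    rfl
  · rfl

theorem IsAlphaMap.injective [Nontrivial ι₁] (h : IsAlphaMap b₁ b₂ α φ) (hα : 0 < α)
    (hα5 : α * (5 : ℕ) ≤ 1) : Function.Injective φ := by
  classical
  have h1 := (h.isSeparated hα hα5).injective le_rfl (repr_map_repr_symm_mk b₁ b₂ φ)
  intro x y hxy
  apply b₁.repr.injective
  apply h1
  simp [hxy]

theorem IsAlphaMap.isPrimitiveSubgroup_range [Nontrivial ι₁] (h : IsAlphaMap b₁ b₂ α φ)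
    (hα : 0 < α) (hα5 : α * (5 : ℕ) ≤ 1) : IsPrimitiveSubgroup φ.range := by
  classical
  rintro y n hn ⟨x, hx⟩
  obtain ⟨v, hv⟩ := (h.isSeparated hα hα5).mem_range_of_pow_mem_range le_rfl
    (repr_map_repr_symm_mk b₁ b₂ φ) hn (y := b₂.repr y) ⟨b₁.repr x, by simp [hx]⟩
  exact ⟨b₁.repr.symm v, b₂.repr.injective (by simpa using hv)⟩

theorem IsAlphaMap.exists_local_retraction [Nontrivial ι₁] (h : IsAlphaMap b₁ b₂ α φ)
    (hα : 0 < α) (js : List (F₂ × F₂)) {K : ℕ} (hK : α * K ≤ 1) (hjs : 6 * js.length + 1 ≤ K) :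
    ∃ ρ : F₂ → F₁, ρ 1 = 1 ∧ (∀ y, ρ y⁻¹ = (ρ y)⁻¹) ∧
      (∀ s, ρ (φ (signedBasis b₁ s)) = signedBasis b₁ s) ∧
      ∀ p ∈ js, ρ (p.1 * p.2) = ρ p.1 * ρ p.2 := by
  classical
  obtain ⟨ρ, h1, h2, h3, h4⟩ := (h.isSeparated hα hK).exists_local_retraction
    (fun i => b₁ i) (js.map (Prod.map b₂.repr b₂.repr)) (by simpa using hjs)
  have h3' : ∀ i, ρ (b₂.repr (φ (b₁ i))) = b₁ i := by
    intro i
    have := h3 i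
    rwa [basisWord, mk_toWord] at this
  refine ⟨fun y => ρ (b₂.repr y), by simpa using h1, fun y => by simp [h2], ?_, fun p hp => ?_⟩
  · rintro ⟨i, _ | _⟩
    · simp [signedBasis, h2, h3']
    · simp [signedBasis, h3']
  · simpa using h4 _ (List.mem_map_of_mem hp)

end AlphaMap

/-! ### Genus does not drop under α-maps -/

/-- The pairs formed by a member of a list and the product of the members that follow it. -/
def tailPairs {G : Type*} [Group G] : List G → List (G × G)
  | [] => []
  | a :: l => (a, l.prod) :: tailPairs l

theorem length_tailPairs {G : Type*} [Group G] (l : List G) :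
    (tailPairs l).length = l.length := by
  induction l with
  | nil => rfl
  | cons a l ih => simp [tailPairs, ih]

theorem map_list_prod_of_tailPairs {G H : Type*} [Group G] [Group H] {ρ : G → H} (h1 : ρ 1 = 1)
    (l : List G) (h : ∀ p ∈ tailPairs l, ρ (p.1 * p.2) = ρ p.1 * ρ p.2) :
    ρ l.prod = (l.map ρ).prod := by
  induction l with
  | nil => simpa using h1
  | cons a l ih =>
    simp only [tailPairs, List.forall_mem_cons] at h
    rw [List.prod_cons, h.1, List.map_cons, List.prod_cons, ih h.2]

theorem map_surfaceBoundary {G : Type*} [Group G] {g : ℕ} (h : SurfaceGroup g →* G) :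
    h (surfaceBoundary g) = (List.ofFn fun i : Fin g =>
      h (FreeGroup.of (i, false)) * h (FreeGroup.of (i, true)) *
        (h (FreeGroup.of (i, false)))⁻¹ * (h (FreeGroup.of (i, true)))⁻¹).prod := by
  rw [surfaceBoundary, map_list_prod, List.map_ofFn]
  congr 2
  ext i
  simp

theorem prod_signedBasis_basisWord {ι F : Type*} [Group F] (b : FreeGroupBasis ι F) (x : F) :
    ((basisWord b x).map (signedBasis b)).prod = x := by
  classical
  apply b.repr.injective
  rw [map_list_prod, List.map_map]
  conv_rhs => rw [← mk_toWord (x := b.repr x)]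
  rw [basisWord]
  generalize (b.repr x).toWord = U
  induction U with
  | nil => rfl
  | cons s U ih =>
    rw [List.map_cons, List.prod_cons, ih, ← List.singleton_append, ← mul_mk]
    congr 1
    obtain ⟨i, _ | _⟩ := s
    · simp only [signedBasis, Function.comp, Bool.false_eq_true, if_false, map_inv,
        FreeGroupBasis.repr_apply_coe]
      rfl
    · simp only [signedBasis, Function.comp, if_true, FreeGroupBasis.repr_apply_coe]
      rfl

/-- φ(x) is a product in two ways: of the images of the letters of x, and of the 4g factors of g
commutators. A local retraction compatible with both products sends the first to x and the second to
g commutators in F₁. -/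
theorem IsAlphaMap.nonempty_genusRep {ι₁ F₁ ι₂ F₂ : Type*} [Group F₁] [Group F₂] [Nontrivial ι₁]
    {b₁ : FreeGroupBasis ι₁ F₁} {b₂ : FreeGroupBasis ι₂ F₂} {α : ℝ} {φ : F₁ →* F₂}
    (h : IsAlphaMap b₁ b₂ α φ) (hα : 0 < α) {x : F₁} {g K : ℕ} (hK : α * K ≤ 1)
    (hgK : 6 * ((basisWord b₁ x).length + 4 * g) + 1 ≤ K) (hx : Nonempty (GenusRep g (φ x))) :
    Nonempty (GenusRep g x) := by
  obtain ⟨f, hf⟩ := hx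
  set l₁ : List F₂ := (basisWord b₁ x).map fun s => φ (signedBasis b₁ s) with hl₁
  set l₂ : List F₂ := (List.ofFn fun i : Fin g => [f (FreeGroup.of (i, false)),
    f (FreeGroup.of (i, true)), (f (FreeGroup.of (i, false)))⁻¹,
    (f (FreeGroup.of (i, true)))⁻¹]).flatten with hl₂
  have hp₁ : l₁.prod = φ x := by
    conv_rhs => rw [← prod_signedBasis_basisWord b₁ x, map_list_prod, List.map_map]
    rfl
  have hp₂ : l₂.prod = φ x := by
    rw [← hf, map_surfaceBoundary, hl₂, List.prod_flatten, List.map_ofFn]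
    congr 2
    ext i
    simp [mul_assoc]
  have hlen : l₂.length = 4 * g := by
    rw [hl₂, List.length_flatten, List.map_ofFn]
    simp [Function.comp_def, List.ofFn_const, mul_comm]
  obtain ⟨ρ, h1, h2, h3, h4⟩ := h.exists_local_retraction hα (tailPairs l₁ ++ tailPairs l₂) hK
    (by simpa [length_tailPairs, hlen, hl₁] using hgK)
  have e₁ := map_list_prod_of_tailPairs h1 l₁ fun p hp => h4 p (List.mem_append_left _ hp)
  have e₂ := map_list_prod_of_tailPairs h1 l₂ fun p hp => h4 p (List.mem_append_right _ hp)
  have e₃ : (l₁.map ρ).prod = x := by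
    conv_rhs => rw [← prod_signedBasis_basisWord b₁ x]
    rw [hl₁, List.map_map]
    congr 2
    ext s
    exact h3 s
  refine ⟨FreeGroup.lift fun i => ρ (f (FreeGroup.of i)), ?_⟩
  rw [map_surfaceBoundary, ← e₃, ← e₁, hp₁, ← hp₂, e₂, hl₂, List.map_flatten, List.prod_flatten,
    List.map_ofFn, List.map_ofFn]
  congr 2
  ext i
  simp [mul_assoc, h2]

/-! ### The symplectic form carried by the boundary element -/

/-- The Heisenberg group over the rationals. -/
@[ext]
structure Heisenberg where
  /-- The first coordinate. -/
  x : ℚ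
  /-- The second coordinate. -/
  y : ℚ
  /-- The central coordinate. -/
  z : ℚ

namespace Heisenberg

instance : Mul Heisenberg := ⟨fun p q => ⟨p.x + q.x, p.y + q.y, p.z + q.z + p.x * q.y⟩⟩
instance : One Heisenberg := ⟨⟨0, 0, 0⟩⟩
instance : Inv Heisenberg := ⟨fun p => ⟨-p.x, -p.y, -p.z + p.x * p.y⟩⟩

@[simp] theorem mul_x (p q : Heisenberg) : (p * q).x = p.x + q.x := rfl
@[simp] theorem mul_y (p q : Heisenberg) : (p * q).y = p.y + q.y := rfl
@[simp] theorem mul_z (p q : Heisenberg) : (p * q).z = p.z + q.z + p.x * q.y := rfl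
@[simp] theorem one_x : (1 : Heisenberg).x = 0 := rfl
@[simp] theorem one_y : (1 : Heisenberg).y = 0 := rfl
@[simp] theorem one_z : (1 : Heisenberg).z = 0 := rfl
@[simp] theorem inv_x (p : Heisenberg) : p⁻¹.x = -p.x := rfl
@[simp] theorem inv_y (p : Heisenberg) : p⁻¹.y = -p.y := rfl
@[simp] theorem inv_z (p : Heisenberg) : p⁻¹.z = -p.z + p.x * p.y := rfl

instance : Group Heisenberg :=
  Group.ofLeftAxioms
    (fun p q r => by ext <;> simp <;> ring)
    (fun p => by ext <;> simp)
    (fun p => by ext <;> simp)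

/-- Commutators are central here, so their symplectic pairings simply add up. -/
theorem prod_commutators {g : ℕ} (p q : Fin g → Heisenberg) :
    (List.ofFn fun i => p i * q i * (p i)⁻¹ * (q i)⁻¹).prod =
      ⟨0, 0, ∑ i, ((p i).x * (q i).y - (q i).x * (p i).y)⟩ := by
  induction g with
  | zero => simp; rfl
  | succ g ih =>
    rw [List.ofFn_succ, List.prod_cons, ih, Fin.sum_univ_succ]
    ext <;> simp; ring

end Heisenberg

section FreeFactor

variable {g : ℕ}

/-- The homomorphism to the rationals with given values on the generators. -/
def rationalHom (p : Fin g × Bool → ℚ) : SurfaceGroup g →* Multiplicative ℚ :=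
  FreeGroup.lift fun i => Multiplicative.ofAdd (p i)

theorem surfaceBoundary_heisenberg (θ : SurfaceGroup g →* Heisenberg) :
    (θ (surfaceBoundary g)).z = ∑ i : Fin g,
      ((θ (FreeGroup.of (i, false))).x * (θ (FreeGroup.of (i, true))).y -
        (θ (FreeGroup.of (i, true))).x * (θ (FreeGroup.of (i, false))).y) := by
  rw [surfaceBoundary, map_list_prod, List.map_ofFn]
  have := Heisenberg.prod_commutators (fun i : Fin g => θ (FreeGroup.of (i, false)))
    (fun i => θ (FreeGroup.of (i, true)))
  simp only [Function.comp_def, map_mul, map_inv]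
  rw [this]

/-- The pullback of rational homomorphisms along an endomorphism of the surface group. -/
def rationalPullback (r : SurfaceGroup g →* SurfaceGroup g) :
    (Fin g × Bool → ℚ) →ₗ[ℚ] (Fin g × Bool → ℚ) where
  toFun p i := (rationalHom p (r (FreeGroup.of i))).toAdd
  map_add' p q := by
    have : rationalHom (p + q) = rationalHom p * rationalHom q := by
      ext i; simp [rationalHom]
    ext i
    simp [this]
  map_smul' c p := by
    have : (AddMonoidHom.toMultiplicative (AddMonoidHom.mulLeft c)).comp (rationalHom p) =
        rationalHom (c • p) := by
      ext i; simp [rationalHom]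
    ext i
    simp [← this]

theorem rationalHom_comp (r : SurfaceGroup g →* SurfaceGroup g) (p : Fin g × Bool → ℚ) :
    (rationalHom p).comp r = rationalHom (rationalPullback r p) := by
  ext i
  simp [rationalHom, rationalPullback]

/-- The homomorphism to the Heisenberg group with given first two coordinates. -/
def heisenbergHom (p q : Fin g × Bool → ℚ) : SurfaceGroup g →* Heisenberg :=
  FreeGroup.lift fun i => ⟨p i, q i, 0⟩

theorem heisenbergHom_x (p q : Fin g × Bool → ℚ) (w : SurfaceGroup g) :
    (heisenbergHom p q w).x = (rationalHom p w).toAdd := by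
  induction w using FreeGroup.induction_on with
  | C1 => simp
  | of i => simp [heisenbergHom, rationalHom]
  | inv_of i hi => simp [hi]
  | mul x y hx hy => simp [hx, hy]

theorem heisenbergHom_y (p q : Fin g × Bool → ℚ) (w : SurfaceGroup g) :
    (heisenbergHom p q w).y = (rationalHom q w).toAdd := by
  induction w using FreeGroup.induction_on with
  | C1 => simp
  | of i => simp [heisenbergHom, rationalHom]
  | inv_of i hi => simp [hi]
  | mul x y hx hy => simp [hx, hy]

/-- Evaluating ∂_g in the Heisenberg group shows that the pullback preserves the symplectic form;
whatever it kills pairs to zero with everything, and the form is nondegenerate. -/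
theorem rationalPullback_injective {r : SurfaceGroup g →* SurfaceGroup g}
    (hr : r (surfaceBoundary g) = surfaceBoundary g) :
    Function.Injective (rationalPullback r) := by
  rw [injective_iff_map_eq_zero]
  intro p hp
  have key : ∀ q : Fin g × Bool → ℚ,
      ∑ i : Fin g, (p (i, false) * q (i, true) - p (i, true) * q (i, false)) = 0 := by
    intro q
    have h1 := surfaceBoundary_heisenberg (heisenbergHom p q)
    have h2 := surfaceBoundary_heisenberg ((heisenbergHom p q).comp r)
    rw [MonoidHom.comp_apply, hr, h1] at h2
    have h3 : ∀ i, (rationalHom p (r (FreeGroup.of i))).toAdd = 0 := fun i => congrFun hp i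
    simp only [MonoidHom.comp_apply, heisenbergHom_x, h3, zero_mul, sub_zero] at h2
    simpa [heisenbergHom_y, rationalHom] using h2
  ext ⟨i, _ | _⟩
  · have := key (Pi.single (i, true) 1)
    simpa [Pi.single_apply] using this
  · have := key (Pi.single (i, false) 1)
    simpa [Pi.single_apply] using this

/-- An endomorphism that fixes the boundary element has no kernel in rational homology. -/
theorem rationalHom_eq_one_of_map_eq_one {r : SurfaceGroup g →* SurfaceGroup g}
    (hr : r (surfaceBoundary g) = surfaceBoundary g) (χ : SurfaceGroup g →* Multiplicative ℚ)
    {w : SurfaceGroup g} (hw : r w = 1) : χ w = 1 := by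
  -- In finite dimension the pullback is also surjective, so χ factors through r.
  obtain ⟨p, hp⟩ := (LinearMap.injective_iff_surjective.1 (rationalPullback_injective hr))
    fun i => (χ (FreeGroup.of i)).toAdd
  have hχ : χ = (rationalHom p).comp r := by
    rw [rationalHom_comp, hp]
    ext i
    simp [rationalHom]
  rw [hχ, MonoidHom.comp_apply, hw, map_one]

end FreeFactor

/-! ### Splittings over the trivial group -/

section Decompositions

variable {H G : Type*} [Group H] [Group G]

theorem amalgamToGroup_of {S : Fin 2 → Subgroup H} {C : Subgroup H} (hC : ∀ i, C ≤ S i) {i : Fin 2}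
    (s : S i) : amalgamToGroup S C hC
      (Monoid.PushoutI.of (φ := fun i => Subgroup.inclusion (hC i)) i s) = s :=
  Monoid.PushoutI.lift_of (φ := fun i => Subgroup.inclusion (hC i)) (fun i => (S i).subtype)
    C.subtype (fun _ => rfl) s

theorem amalgamToGroup_base {S : Fin 2 → Subgroup H} {C : Subgroup H} (hC : ∀ i, C ≤ S i) (c : C) :
    amalgamToGroup S C hC
      (Monoid.PushoutI.base (fun i => Subgroup.inclusion (hC i)) c) = c :=
  Monoid.PushoutI.lift_base (φ := fun i => Subgroup.inclusion (hC i)) (fun i => (S i).subtype)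
    C.subtype (fun _ => rfl) c

theorem IsAmalgam.closure_eq_top {S : Fin 2 → Subgroup H} {C : Subgroup H} (h : IsAmalgam S C) :
    S 0 ⊔ S 1 = ⊤ := by
  obtain ⟨hC, hbij⟩ := h
  rw [eq_top_iff]
  rintro x -
  obtain ⟨y, rfl⟩ := hbij.2 x
  induction y using Monoid.PushoutI.induction_on with
  | of i y =>
    rw [amalgamToGroup_of]
    fin_cases i
    · exact Subgroup.mem_sup_left y.2
    · exact Subgroup.mem_sup_right y.2
  | base y =>
    rw [amalgamToGroup_base]
    exact Subgroup.mem_sup_left (hC 0 y.2)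
  | mul x y hx hy => rw [map_mul]; exact mul_mem hx hy

theorem IsAmalgam.exists_hom {S : Fin 2 → Subgroup H} {C : Subgroup H} (h : IsAmalgam S C)
    (hC : C = ⊥) (f : ∀ i, S i →* G) : ∃ F : H →* G, ∀ i (s : S i), F s = f i s := by
  obtain ⟨hCS, hbij⟩ := h
  let e := MulEquiv.ofBijective _ hbij
  refine ⟨(Monoid.PushoutI.lift f 1 ?_).comp e.symm.toMonoidHom, fun i s => ?_⟩
  · intro i
    ext ⟨c, hc⟩
    subst hC
    rw [Subgroup.mem_bot] at hc
    subst hc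
    exact map_one (f i)
  · have h2 : e.symm s = Monoid.PushoutI.of (φ := fun i => Subgroup.inclusion (hCS i)) i s :=
      e.symm_apply_eq.2 (amalgamToGroup_of hCS s).symm
    simp [h2]

theorem IsHNN.closure_eq_top {A : Subgroup H} {C C' : Subgroup A} {φ : C ≃* C'} {t : H}
    (h : IsHNN A C C' φ t) : A ⊔ Subgroup.zpowers t = ⊤ := by
  obtain ⟨ht, hbij⟩ := h
  rw [eq_top_iff]
  rintro x -
  obtain ⟨y, rfl⟩ := hbij.2 x
  induction y using HNNExtension.induction_on with
  | of y =>
    rw [HNNExtension.lift_of]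
    exact Subgroup.mem_sup_left y.2
  | t =>
    rw [HNNExtension.lift_t]
    exact Subgroup.mem_sup_right (Subgroup.mem_zpowers t)
  | mul x y hx hy => rw [map_mul]; exact mul_mem hx hy
  | inv x hx => rw [map_inv]; exact inv_mem hx

theorem IsHNN.exists_hom {A : Subgroup H} {C C' : Subgroup A} {φ : C ≃* C'} {t : H}
    (h : IsHNN A C C' φ t) (hC : C = ⊥) (f : A →* G) (x : G) :
    ∃ F : H →* G, (∀ a : A, F a = f a) ∧ F t = x := by
  obtain ⟨ht, hbij⟩ := h
  let e := MulEquiv.ofBijective _ hbij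
  have hφ : ∀ c : C', ((φ.symm c : C) : A) = 1 := by
    intro c
    exact Subgroup.mem_bot.1 (hC.le (φ.symm c).2)
  have hc1 : ∀ c : C', (c : A) = 1 := by
    intro c
    have h1 : φ.symm c = 1 := Subtype.ext (hφ c)
    have h2 : c = 1 := φ.symm.injective (h1.trans (map_one _).symm)
    rw [h2]; rfl
  refine ⟨(HNNExtension.lift f x ?_).comp e.symm.toMonoidHom, fun a => ?_, ?_⟩
  · intro c
    rw [hφ, hc1, map_one, one_mul, mul_one]
  · have h2 : e.symm a = HNNExtension.of a :=
      e.symm_apply_eq.2 (HNNExtension.lift_of A.subtype t ht a).symm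
    simp [h2]
  · have h2 : e.symm t = HNNExtension.t :=
      e.symm_apply_eq.2 (HNNExtension.lift_t A.subtype t ht).symm
    simp [h2]

theorem exists_ne_one_of_isFreeGroup [IsFreeGroup H] {b : H} (hb : b ≠ 1) :
    ∃ (χ : H →* Multiplicative ℚ) (c : H), χ c ≠ 1 := by
  let e := IsFreeGroup.mulEquiv H
  have hne : Nonempty (IsFreeGroup.Generators H) := by
    by_contra hne
    rw [not_nonempty_iff] at hne
    exact hb (e.symm.injective (Subsingleton.elim _ _))
  obtain ⟨i⟩ := hne
  refine ⟨(FreeGroup.lift fun _ => Multiplicative.ofAdd 1).comp e.symm.toMonoidHom,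
    e (FreeGroup.of i), ?_⟩
  simp

/-- The retraction r onto `S 0` that kills `S 1` fixes ∂_g. If `S 1` were nontrivial, it would be
free with a nontrivial rational character; extended to H_g, this character would be nontrivial on
the kernel of r. -/
theorem IsAmalgam.eq_bot_of_surfaceBoundary_mem {g : ℕ} {S : Fin 2 → Subgroup (SurfaceGroup g)}
    {C : Subgroup (SurfaceGroup g)} (h : IsAmalgam S C) (hC : C = ⊥)
    (hg : surfaceBoundary g ∈ S 0) : S 1 = ⊥ := by
  by_contra hne
  obtain ⟨b, hb⟩ := (S 1).ne_bot_iff_exists_ne_one.1 hne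
  obtain ⟨χ₀, c, hc⟩ := exists_ne_one_of_isFreeGroup hb
  obtain ⟨r, hr⟩ := h.exists_hom hC (G := SurfaceGroup g) (Fin.cons (S 0).subtype (fun _ => 1))
  obtain ⟨χ, hχ⟩ := h.exists_hom hC (Fin.cons 1 (Fin.cons χ₀ fun i => i.elim0))
  refine hc ?_
  have := rationalHom_eq_one_of_map_eq_one (hr 0 ⟨_, hg⟩) χ (hr 1 c)
  rwa [hχ 1 c] at this

/-- Over a trivial C, killing t fixes ∂_g, although a rational character detects t. -/
theorem IsHNN.ne_bot_of_surfaceBoundary_mem {g : ℕ} {A : Subgroup (SurfaceGroup g)}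
    {C C' : Subgroup A} {φ : C ≃* C'} {t : SurfaceGroup g} (h : IsHNN A C C' φ t)
    (hg : surfaceBoundary g ∈ A) : C ≠ ⊥ := by
  intro hC
  obtain ⟨r, hr, hrt⟩ := h.exists_hom hC A.subtype 1
  obtain ⟨χ, -, hχ⟩ := h.exists_hom hC (1 : A →* Multiplicative ℚ) (Multiplicative.ofAdd 1)
  have := rationalHom_eq_one_of_map_eq_one (hr ⟨_, hg⟩) χ hrt
  rw [hχ] at this
  simp at this

end Decompositions

/-! ### Twists and counts under a root-closed embedding -/

section Twists

variable {G G' : Type*} [Group G] [Group G'] {g : ℕ} {x : G}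

/-- The composition of a representation with a homomorphism. -/
def GenusRep.map (φ : G →* G') (h : GenusRep g x) : GenusRep g (φ x) :=
  ⟨φ.comp h.1, by rw [MonoidHom.comp_apply, h.2]⟩

theorem GenusRep.map_apply (φ : G →* G') (h : GenusRep g x) (w : SurfaceGroup g) :
    (h.map φ).1 w = φ (h.1 w) := rfl

theorem GenusRep.map_injective {φ : G →* G'} (hφ : Function.Injective φ) :
    Function.Injective (GenusRep.map (g := g) (x := x) φ) := by
  intro h h' hh
  refine Subtype.ext (MonoidHom.ext fun w => hφ ?_)
  rw [← GenusRep.map_apply, hh, GenusRep.map_apply]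

theorem FractionalDehnTwist.symm {h h' : GenusRep g x} (hh : FractionalDehnTwist h h') :
    FractionalDehnTwist h' h := by
  rcases hh with ⟨S, C, hS, hC, hg, z, h1, h2, h3⟩ | ⟨A, C, C', φ, t, hA, hC, hg, z, h1, h2, h3⟩
  · refine Or.inl ⟨S, C, hS, hC, hg, z⁻¹, fun c hc => ?_, fun a ha => (h2 a ha).symm,
      fun b hb => ?_⟩
    · rw [h2 c (hS.1 0 hc), inv_mul_eq_iff_eq_mul, ← mul_assoc, h1 c hc, mul_inv_cancel_right]
    · rw [h3 b hb]; group
  · refine Or.inr ⟨A, C, C', φ, t, hA, hC, hg, z⁻¹, fun c hc => ?_, fun a ha => (h2 a ha).symm, ?_⟩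
    · rw [h2 c c.2, inv_mul_eq_iff_eq_mul, ← mul_assoc, h1 c hc, mul_inv_cancel_right]
    · rw [h3, inv_mul_cancel_left]

theorem FractionalDehnTwist.map (φ : G →* G') {h h' : GenusRep g x}
    (hh : FractionalDehnTwist h h') : FractionalDehnTwist (h.map φ) (h'.map φ) := by
  rcases hh with ⟨S, C, hS, hC, hg, z, h1, h2, h3⟩ | ⟨A, C, C', ψ, t, hA, hC, hg, z, h1, h2, h3⟩
  · refine Or.inl ⟨S, C, hS, hC, hg, φ z, fun c hc => ?_, fun a ha => ?_, fun b hb => ?_⟩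
    · simp only [GenusRep.map_apply, ← map_mul, h1 c hc]
    · simp only [GenusRep.map_apply, h2 a ha]
    · simp only [GenusRep.map_apply, h3 b hb, map_mul, map_inv]
  · refine Or.inr ⟨A, C, C', ψ, t, hA, hC, hg, φ z, fun c hc => ?_, fun a ha => ?_, ?_⟩
    · simp only [GenusRep.map_apply, ← map_mul, h1 c hc]
    · simp only [GenusRep.map_apply, h2 a ha]
    · simp only [GenusRep.map_apply, h3, map_mul]

theorem GenusRep.exists_map_eq {φ : G →* G'} (hφ : Function.Injective φ) (k : GenusRep g (φ x))
    (hk : ∀ w, k.1 w ∈ φ.range) : ∃ h : GenusRep g x, h.map φ = k := by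
  have hf : ∀ w, φ ((MonoidHom.ofInjective hφ).symm (k.1.codRestrict φ.range hk w)) = k.1 w :=
    fun w => congrArg Subtype.val
      ((MonoidHom.ofInjective hφ).apply_symm_apply (k.1.codRestrict φ.range hk w))
  refine ⟨⟨(MonoidHom.ofInjective hφ).symm.toMonoidHom.comp (k.1.codRestrict φ.range hk),
    hφ ((hf _).trans k.2)⟩, ?_⟩
  exact Subtype.ext (MonoidHom.ext hf)

/-- The twisting element commutes with a nontrivial element of φ(G) as soon as C ≠ 1, and root
closure then places it in φ(G). -/
theorem FractionalDehnTwist.exists_of_map [IsFreeGroup G'] {φ : G →* G'}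
    (hφ : Function.Injective φ) (hprim : IsPrimitiveSubgroup φ.range) {h : GenusRep g x}
    (hh : Function.Injective h.1) {k : GenusRep g (φ x)} (hk : FractionalDehnTwist (h.map φ) k) :
    ∃ h', FractionalDehnTwist h h' ∧ h'.map φ = k := by
  have hmem : ∀ {z : G'} {c : SurfaceGroup g}, c ≠ 1 → z * φ (h.1 c) = φ (h.1 c) * z →
      ∃ z₀, φ z₀ = z ∧ z₀ * h.1 c = h.1 c * z₀ := by
    intro z c hc hz
    have hne : φ (h.1 c) ≠ 1 := by
      rw [Ne, map_eq_one_iff φ hφ, map_eq_one_iff h.1 hh]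
      exact hc
    obtain ⟨z₀, rfl⟩ := hprim.mem_of_commute ⟨h.1 c, rfl⟩ hne hz
    exact ⟨z₀, rfl, hφ (by rw [map_mul, map_mul, hz])⟩
  rcases hk with ⟨S, C, hS, hC, hg, z, h1, h2, h3⟩ | ⟨A, C, C', ψ, t, hA, hC, hg, z, h1, h2, h3⟩
  · simp only [GenusRep.map_apply] at h1 h2 h3
    obtain ⟨z₀, hz₀, hz₁⟩ : ∃ z₀ : G, (∀ c ∈ C, z₀ * h.1 c = h.1 c * z₀) ∧
        ∀ b ∈ S 1, k.1 b = φ (z₀ * h.1 b * z₀⁻¹) := by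
      -- If C is trivial, z may lie outside φ(G), but it conjugates only the trivial group, so 1
      -- replaces it.
      by_cases hbot : C = ⊥
      · have hS1 := hS.eq_bot_of_surfaceBoundary_mem hbot hg
        refine ⟨1, by simp, fun b hb => ?_⟩
        rw [hS1, Subgroup.mem_bot] at hb
        simp [hb]
      · obtain ⟨c₀, hc₀, hne⟩ := (C.bot_or_exists_ne_one).resolve_left hbot
        obtain ⟨z₀, rfl, -⟩ := hmem hne (h1 c₀ hc₀)
        refine ⟨z₀, fun c hc => hφ ?_, fun b hb => ?_⟩
        · rw [map_mul, map_mul, h1 c hc]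
        · rw [h3 b hb, map_mul, map_mul, map_inv]
    have hrange : ∀ w, k.1 w ∈ φ.range := by
      have hle : S 0 ⊔ S 1 ≤ φ.range.comap k.1 := by
        refine sup_le (fun a ha => ?_) fun b hb => ?_
        · exact ⟨_, (h2 a ha).symm⟩
        · exact ⟨_, (hz₁ b hb).symm⟩
      rw [hS.closure_eq_top] at hle
      exact fun w => hle (Subgroup.mem_top w)
    obtain ⟨h', rfl⟩ := k.exists_map_eq hφ hrange
    exact ⟨h', Or.inl ⟨S, C, hS, hC, hg, z₀, hz₀, fun a ha => hφ (h2 a ha),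
      fun b hb => hφ (hz₁ b hb)⟩, rfl⟩
  · simp only [GenusRep.map_apply] at h1 h2 h3
    obtain ⟨c₀, hc₀, hne⟩ :=
      (C.bot_or_exists_ne_one).resolve_left (hA.ne_bot_of_surfaceBoundary_mem hg)
    obtain ⟨z₀, rfl, -⟩ := hmem (by simpa using hne) (h1 c₀ hc₀)
    have hrange : ∀ w, k.1 w ∈ φ.range := by
      have hle : A ⊔ Subgroup.zpowers t ≤ φ.range.comap k.1 := by
        refine sup_le (fun a ha => ⟨_, (h2 a ha).symm⟩) ?_
        rw [Subgroup.zpowers_le]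
        exact ⟨z₀ * h.1 t, by rw [h3, map_mul]⟩
      rw [hA.closure_eq_top] at hle
      exact fun w => hle (Subgroup.mem_top w)
    obtain ⟨h', rfl⟩ := k.exists_map_eq hφ hrange
    refine ⟨h', Or.inr ⟨A, C, C', ψ, t, hA, hC, hg, z₀, fun c hc => hφ ?_,
      fun a ha => hφ (h2 a ha), hφ ?_⟩, rfl⟩
    · rw [map_mul, map_mul, h1 c hc]
    · rw [← GenusRep.map_apply, h3, map_mul]

theorem twistSetoid_map (φ : G →* G') {h h' : GenusRep g x} (hh : twistSetoid g x h h') :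
    twistSetoid g (φ x) (h.map φ) (h'.map φ) := by
  induction hh with
  | rel h h' hh => exact .rel _ _ (hh.map φ)
  | refl h => exact .refl _
  | symm h h' _ ih => exact .symm _ _ ih
  | trans h h' h'' _ _ ih ih' => exact .trans _ _ _ ih ih'

/-- Twists lift one at a time. Each step requires injectivity of the representation reached so far,
which is why ∼-injectivity, rather than injectivity of `h` alone, is assumed. -/
theorem IsTwistInjective.exists_of_twistSetoid_map [IsFreeGroup G'] {φ : G →* G'}
    (hφ : Function.Injective φ) (hprim : IsPrimitiveSubgroup φ.range) {h : GenusRep g x}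
    (hh : IsTwistInjective h) {k : GenusRep g (φ x)} (hk : twistSetoid g (φ x) (h.map φ) k) :
    ∃ h', twistSetoid g x h h' ∧ h'.map φ = k := by
  have step : ∀ k k' : GenusRep g (φ x), FractionalDehnTwist k k' →
      (∃ h', twistSetoid g x h h' ∧ h'.map φ = k) →
      ∃ h', twistSetoid g x h h' ∧ h'.map φ = k' := by
    rintro k k' hkk ⟨h', hh', rfl⟩
    obtain ⟨h'', h1, h2⟩ := hkk.exists_of_map hφ hprim (hh h' hh')
    exact ⟨h'', .trans _ _ _ hh' (.rel _ _ h1), h2⟩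
  have key : ∀ k k' : GenusRep g (φ x), twistSetoid g (φ x) k k' →
      ((∃ h', twistSetoid g x h h' ∧ h'.map φ = k) ↔
        ∃ h', twistSetoid g x h h' ∧ h'.map φ = k') := by
    intro k k' hkk
    induction hkk with
    | rel k k' hkk => exact ⟨step k k' hkk, step k' k hkk.symm⟩
    | refl k => exact Iff.rfl
    | symm k k' _ ih => exact ih.symm
    | trans k k' k'' _ _ ih ih' => exact ih.trans ih'
  exact (key _ _ hk).1 ⟨h, .refl _, rfl⟩

theorem numClasses_le_numClasses_map [IsFreeGroup G'] {φ : G →* G'}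
    (hφ : Function.Injective φ) (hprim : IsPrimitiveSubgroup φ.range) (g : ℕ) (x : G) :
    numClasses g x ≤ numClasses g (φ x) := by
  refine Set.encard_le_encard_of_injOn
    (f := Quotient.map (GenusRep.map φ) fun _ _ hh => twistSetoid_map φ hh) ?_ ?_
  · rintro _ ⟨h, hh, rfl⟩
    refine ⟨h.map φ, fun k hk => ?_, rfl⟩
    obtain ⟨h', hh', rfl⟩ := hh.exists_of_twistSetoid_map hφ hprim hk
    exact hφ.comp (hh h' hh')
  · rintro _ ⟨h, hh, rfl⟩ _ ⟨h', hh', rfl⟩ heq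
    obtain ⟨h'', h1, h2⟩ := hh.exists_of_twistSetoid_map hφ hprim (Quotient.exact heq)
    rw [← GenusRep.map_injective hφ h2]
    exact Quotient.sound h1

theorem numImages_le_numImages_map {φ : G →* G'} (hφ : Function.Injective φ)
    (hprim : IsPrimitiveSubgroup φ.range) (g : ℕ) (x : G) :
    numImages g x ≤ numImages g (φ x) := by
  refine Set.encard_le_encard_of_injOn (f := Subgroup.map φ) ?_
    (Subgroup.map_injective hφ).injOn
  rintro _ ⟨h, ⟨hinj, hh⟩, rfl⟩
  have hr : (h.map φ).1.range = h.1.range.map φ := MonoidHom.range_comp _ _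
  refine ⟨h.map φ, ⟨hφ.comp hinj, ?_⟩, hr⟩
  rw [hr]
  rintro y n hn ⟨w, hw, hwy⟩
  obtain ⟨y, rfl⟩ := hprim y n hn ⟨w, hwy⟩
  rw [← map_pow] at hwy
  exact ⟨y, hh y n hn (hφ hwy ▸ hw), rfl⟩

end Twists

/-! ### Choice of α for a given element -/

theorem exists_genusRep_of_mem_commutator {G : Type*} [Group G] {x : G} (hx : x ∈ commutator G) :
    ∃ g, Nonempty (GenusRep g x) := by
  have key : ∃ l : List (G × G), (l.map fun p => p.1 * p.2 * p.1⁻¹ * p.2⁻¹).prod = x := by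
    rw [commutator_eq_closure] at hx
    induction hx using Subgroup.closure_induction with
    | mem x hx =>
      obtain ⟨a, b, rfl⟩ := hx
      exact ⟨[(a, b)], by simp [commutatorElement_def]⟩
    | one => exact ⟨[], rfl⟩
    | mul x y _ _ hx hy =>
      obtain ⟨l, rfl⟩ := hx
      obtain ⟨l', rfl⟩ := hy
      exact ⟨l ++ l', by simp⟩
    | inv x _ hx =>
      obtain ⟨l, rfl⟩ := hx
      refine ⟨(l.map Prod.swap).reverse, ?_⟩
      rw [List.prod_inv_reverse, List.map_reverse, List.map_map, List.map_map]
      congr 3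
      ext p
      simp [mul_assoc]
  obtain ⟨l, rfl⟩ := key
  refine ⟨l.length, FreeGroup.lift fun i => if i.2 then (l.get i.1).2 else (l.get i.1).1, ?_⟩
  rw [map_surfaceBoundary]
  conv_rhs => rw [← List.ofFn_get l, List.map_ofFn]
  congr 2
  ext i
  simp

/-- Small `α` such that `α`-maps do not decrease the counts of `x`, nor its genus. -/
theorem exists_alpha {ι₁ F₁ : Type*} [Nontrivial ι₁] [Group F₁] (b₁ : FreeGroupBasis ι₁ F₁)
    {x : F₁} (hx : x ∈ commutator F₁) :
    ∃ α : ℝ, 0 < α ∧ ∀ (ι₂ : Type*) (F₂ : Type*) [Group F₂] (b₂ : FreeGroupBasis ι₂ F₂)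
      (φ : F₁ →* F₂), IsAlphaMap b₁ b₂ α φ →
        algGenus (φ x) = algGenus x ∧ minNumImages x ≤ minNumImages (φ x) ∧
          minNumClasses x ≤ minNumClasses (φ x) := by
  -- The main term serves the local retraction, the 5 serves injectivity and root closure. The genus
  -- of x may stand for that of φ(x), which is not larger.
  set K : ℕ := 6 * ((basisWord b₁ x).length + 4 * algGenus x) + 5 with hK
  have hK0 : (0 : ℝ) < K := by positivity
  refine ⟨1 / K, by positivity, fun ι₂ F₂ _ b₂ φ h => ?_⟩
  have hα : (0 : ℝ) < 1 / K := by positivity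
  have hα5 : 1 / (K : ℝ) * (5 : ℕ) ≤ 1 := by
    rw [one_div_mul_eq_div, div_le_one hK0]
    exact_mod_cast (by omega : 5 ≤ K)
  have hinj := h.injective hα hα5
  have hprim := h.isPrimitiveSubgroup_range hα hα5
  have := b₂.isFreeGroup
  -- Membership in the commutator subgroup ensures that the infimum is attained and is not the
  -- default value 0 of an empty set.
  have hrep : Nonempty (GenusRep (algGenus x) x) :=
    Nat.sInf_mem (s := {g | Nonempty (GenusRep g x)}) (exists_genusRep_of_mem_commutator hx)
  have hrep' : Nonempty (GenusRep (algGenus x) (φ x)) := hrep.map (GenusRep.map φ)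
  have hle : algGenus (φ x) ≤ algGenus x := Nat.sInf_le hrep'
  have hmem : Nonempty (GenusRep (algGenus (φ x)) (φ x)) :=
    Nat.sInf_mem (s := {g | Nonempty (GenusRep g (φ x))}) ⟨_, hrep'⟩
  have hge : algGenus x ≤ algGenus (φ x) :=
    Nat.sInf_le (h.nonempty_genusRep hα (K := K) (by field_simp; rfl) (by omega) hmem)
  have heq := le_antisymm hle hge
  refine ⟨heq, ?_, ?_⟩
  · rw [minNumImages, minNumImages, heq]
    exact numImages_le_numImages_map hinj hprim _ _
  · rw [minNumClasses, minNumClasses, heq]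
    exact numClasses_le_numClasses_map hinj hprim _ _

/-! ### Construction of α-maps from the sequence of squares -/

/-- The window after p contains two consecutive squares n² and (n + 1)². The corresponding squares
after q are again consecutive, and their gap 2n + 1 determines them. -/
theorem eq_of_isSquare_add_iff {p q L T : ℕ} (hp : p < T ^ 2) (hL : 4 * T + 4 ≤ L)
    (h : ∀ r < L, IsSquare (p + r) ↔ IsSquare (q + r)) : p = q := by
  obtain ⟨n, hn, hmin⟩ : ∃ n, p ≤ n ^ 2 ∧ ∀ j < n, j ^ 2 < p :=
    have hex : ∃ n, p ≤ n ^ 2 := ⟨T, hp.le⟩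
    ⟨Nat.find hex, Nat.find_spec hex, fun j hj => not_le.1 (Nat.find_min hex hj)⟩
  have hnT : n ≤ T := by
    by_contra! hlt
    exact absurd (hmin T hlt) hp.le.not_gt
  have hn2 : n ^ 2 ≤ p + 2 * T := by
    obtain _ | n := n
    · simp
    · have := hmin n (Nat.lt_succ_self n)
      nlinarith
  obtain ⟨m, hm⟩ : IsSquare (q + (n ^ 2 - p)) :=
    (h _ (by omega)).1 ⟨n, by rw [Nat.add_sub_cancel' hn]; ring⟩
  obtain ⟨l, hl⟩ : IsSquare (q + (n ^ 2 + 2 * n + 1 - p)) :=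
    (h _ (by omega)).1 ⟨n + 1, by rw [Nat.add_sub_cancel' (by omega)]; ring⟩
  have hlm : l * l = m * m + 2 * n + 1 := by omega
  have hmn : m = n := by
    have h1 : m + 1 ≤ l := by
      by_contra! hlt
      have : l * l ≤ m * m := Nat.mul_le_mul (by omega) (by omega)
      omega
    rcases h1.eq_or_lt with h2 | h2
    · subst h2
      nlinarith
    · exfalso
      have h3 : (m + 1) * (m + 1) < l * l := Nat.mul_self_lt_mul_self h2
      have h4 : (m + 1) * (m + 1) = m * m + 2 * m + 1 := by ring
      obtain ⟨s, hs⟩ : IsSquare (p + ((n ^ 2 - p) + (2 * m + 1))) :=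
        (h _ (by omega)).2 ⟨m + 1, by omega⟩
      have h5 : s * s = n * n + 2 * m + 1 := by rw [← pow_two n]; omega
      have h6 : n < s := by
        by_contra! hlt
        have : s * s ≤ n * n := Nat.mul_le_mul hlt hlt
        omega
      have h7 : s < n + 1 := by
        by_contra! hlt
        have : (n + 1) * (n + 1) ≤ s * s := Nat.mul_le_mul hlt hlt
        nlinarith
      omega
  subst hmn
  rw [pow_two] at hn hm
  omega

/-- For every `α > 0` there are `α`-maps between any two free groups, the first one of finite rank
and the second one nonabelian. -/
theorem exists_isAlphaMap {ι₁ F₁ ι₂ F₂ : Type*} [Finite ι₁] [Nonempty ι₁] [Nontrivial ι₂]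
    [Group F₁] [Group F₂] (b₁ : FreeGroupBasis ι₁ F₁) (b₂ : FreeGroupBasis ι₂ F₂) {α : ℝ}
    (hα : 0 < α) : ∃ φ : F₁ →* F₂, IsAlphaMap b₁ b₂ α φ := by
  classical
  obtain ⟨k, ⟨e⟩⟩ := Finite.exists_equiv_fin ι₁
  have hk : 0 < k := Fin.pos_iff_nonempty.2 (e.symm.nonempty)
  obtain ⟨c, d, hcd⟩ := exists_pair_ne ι₂
  obtain ⟨N, hN⟩ := exists_nat_gt (8 / α)
  have hN0 : 0 < N := by
    have : (0 : ℝ) < N := lt_trans (by positivity) hN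
    exact_mod_cast this
  -- The k blocks of length Q fill [0, T²) with T = kN, and αQ = (αN)T > 8T ≥ 4T + 4, the window
  -- length that identifies a position.
  set Q := k * N ^ 2 with hQ
  have hQα : (4 * (k * N) + 4 : ℝ) ≤ α * Q := by
    have h1 : 8 < α * N := by rwa [div_lt_iff₀ hα, mul_comm] at hN
    have h2 : (1 : ℝ) ≤ k * N := by exact_mod_cast Nat.mul_pos hk hN0
    have h3 : α * (Q : ℝ) = (α * N) * (k * N) := by rw [hQ]; push_cast; ring
    rw [h3]
    nlinarith
  -- Block number `e i` of the indicator sequence of the squares, written with two positive letters.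
  let W : ι₁ → List (ι₂ × Bool) := fun i =>
    (List.range Q).map fun j => (if IsSquare ((e i : ℕ) * Q + j) then c else d, true)
  have hWl : ∀ i, (W i).length = Q := fun i => by simp [W]
  have hWpos : ∀ i, ∀ a ∈ W i, a.2 = true := by
    intro i a ha
    obtain ⟨j, -, rfl⟩ := List.mem_map.1 ha
    rfl
  have hWred : ∀ i, IsReduced (W i) := by
    intro i
    have h1 : (W i).Pairwise fun a b => a.1 = b.1 → a.2 = b.2 :=
      List.pairwise_iff_forall_sublist.2 fun {a b} hab _ => by
        rw [hWpos i a (hab.subset (by simp)), hWpos i b (hab.subset (by simp))]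
    exact h1.isChain
  set φ : F₁ →* F₂ := b₁.lift fun i => b₂.repr.symm (FreeGroup.mk (W i)) with hφ
  have hφW : ∀ i, basisWord b₂ (φ (b₁ i)) = W i := by
    intro i
    have : φ (b₁ i) = b₂.repr.symm (FreeGroup.mk (W i)) :=
      congrFun (b₁.lift.symm_apply_apply _) i
    rw [basisWord, this, MulEquiv.apply_symm_apply, toWord_mk, (hWred i).reduce_eq]
  have hm : Q ≤ minImageLength b₁ b₂ φ := by
    refine le_ciInf fun i => ?_
    rw [hφW, hWl]
  have hlong : ∀ w : List (ι₂ × Bool), α * (minImageLength b₁ b₂ φ : ℝ) ≤ w.length →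
      4 * (k * N) + 4 ≤ w.length := by
    intro w hw
    have h1 : α * (Q : ℝ) ≤ α * (minImageLength b₁ b₂ φ : ℝ) :=
      mul_le_mul_of_nonneg_left (by exact_mod_cast hm) hα.le
    exact_mod_cast (hQα.trans h1).trans hw
  have huniq : ∀ i j s w t s' t', 4 * (k * N) + 4 ≤ w.length → W i = s ++ w ++ t →
      W j = s' ++ w ++ t' → i = j ∧ s.length = s'.length := by
    intro i j s w t s' t' hw h1 h2
    have hl1 := congrArg List.length h1
    have hl2 := congrArg List.length h2
    simp only [hWl, List.length_append] at hl1 hl2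
    have hget : ∀ (i : ι₁) (s t : List (ι₂ × Bool)), W i = s ++ w ++ t → ∀ r, r < w.length →
        (IsSquare ((e i : ℕ) * Q + s.length + r) ↔ w[r]? = some (c, true)) := by
      intro i s t h r hr
      have h3 : (W i)[s.length + r]? = w[r]? := by
        rw [h, List.append_assoc, List.getElem?_append_right (by omega),
          List.getElem?_append_left (by omega), Nat.add_sub_cancel_left]
      have hl := congrArg List.length h
      simp only [hWl, List.length_append] at hl
      have h4 : (W i)[s.length + r]? =
          some (if IsSquare ((e i : ℕ) * Q + (s.length + r)) then c else d, true) := by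
        simp only [W, List.getElem?_map]
        rw [List.getElem?_range (by omega)]
        rfl
      rw [← h3, h4, ← add_assoc]
      by_cases hsq : IsSquare ((e i : ℕ) * Q + s.length + r)
      · simp [hsq]
      · simp [hsq, hcd.symm]
    have hpos : ∀ i : ι₁, (e i : ℕ) * Q + Q ≤ (k * N) ^ 2 := by
      intro i
      calc (e i : ℕ) * Q + Q = ((e i : ℕ) + 1) * Q := by ring
        _ ≤ k * Q := Nat.mul_le_mul_right _ (e i).2
        _ = (k * N) ^ 2 := by rw [hQ]; ring
    have heq := eq_of_isSquare_add_iff (p := (e i : ℕ) * Q + s.length)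
      (q := (e j : ℕ) * Q + s'.length) (by have := hpos i; omega) hw
      fun r hr => (hget i s t h1 r hr).trans (hget j s' t' h2 r hr).symm
    have hs : s.length < Q := by omega
    have hs' : s'.length < Q := by omega
    have hij : (e i : ℕ) = e j := by
      have h3 := congrArg (· / Q) heq
      simpa [Nat.add_div_of_dvd_right, Nat.mul_div_cancel _ (show 0 < Q by omega),
        Nat.div_eq_of_lt hs, Nat.div_eq_of_lt hs'] using h3
    refine ⟨e.injective (Fin.ext hij), ?_⟩
    rw [hij] at heq
    omega
  refine ⟨φ, fun i w s t s' t' hw h1 h2 => ?_, fun u v w hw hu hv => ?_⟩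
  · rw [hφW] at h1 h2
    have hlen := (huniq i i s w t s' t' (hlong w hw) h1 h2).2
    have h3 := h1.symm.trans h2
    rw [List.append_assoc, List.append_assoc] at h3
    obtain ⟨rfl, h4⟩ := List.append_inj h3 hlen
    exact ⟨rfl, List.append_cancel_left h4⟩
  · have hw' := hlong w hw
    obtain ⟨a, ha⟩ : ∃ a, a ∈ w := List.exists_mem_of_length_pos (by omega)
    have hneg : ∀ i, basisWord b₂ (φ (signedBasis b₁ (i, false))) = invRev (W i) := by
      intro i
      simp [signedBasis, basisWord_inv, hφW]
    have hposw : ∀ i, basisWord b₂ (φ (signedBasis b₁ (i, true))) = W i := by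
      intro i
      simp [signedBasis, hφW]
    -- All the words `W i` are positive, so a single letter of a common subword decides between a
    -- basis element and an inverse.
    have hsign : ∀ s : ι₁ × Bool, w <:+: basisWord b₂ (φ (signedBasis b₁ s)) → a.2 = s.2 := by
      rintro ⟨i, _ | _⟩ hs
      · rw [hneg] at hs
        have h1 := hs.subset ha
        simp only [invRev, List.mem_reverse, List.mem_map] at h1
        obtain ⟨a', ha', rfl⟩ := h1
        simp [hWpos i a' ha']
      · rw [hposw] at hs
        exact hWpos i a (hs.subset ha)
    have hsuv := (hsign u hu).symm.trans (hsign v hv)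
    obtain ⟨i, bi⟩ := u
    obtain ⟨j, bj⟩ := v
    obtain rfl : bi = bj := hsuv
    obtain ⟨s, t, h1⟩ := hu
    obtain ⟨s', t', h2⟩ := hv
    cases bi
    · rw [hneg] at h1 h2
      have h3 := congrArg invRev h1
      have h4 := congrArg invRev h2
      rw [invRev_invRev, invRev_append, invRev_append, ← List.append_assoc] at h3 h4
      rw [(huniq i j _ _ _ _ _ (by simpa using hw') h3.symm h4.symm).1]
    · rw [hposw] at h1 h2
      rw [(huniq i j _ _ _ _ _ hw' h1.symm h2.symm).1]

/-! ### Comparison of the suprema -/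

theorem exists_hom_le_counts {ι₁ F₁ ι₂ F₂ : Type*} [Finite ι₁] [Nontrivial ι₁] [Nontrivial ι₂]
    [Group F₁] [Group F₂] (b₁ : FreeGroupBasis ι₁ F₁) (b₂ : FreeGroupBasis ι₂ F₂) {x : F₁}
    (hx : x ∈ commutator F₁) :
    ∃ y ∈ commutator F₂, algGenus y = algGenus x ∧ minNumImages x ≤ minNumImages y ∧
      minNumClasses x ≤ minNumClasses y := by
  obtain ⟨α, hα, h⟩ := exists_alpha b₁ hx
  obtain ⟨φ, hφ⟩ := exists_isAlphaMap b₁ b₂ hα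
  refine ⟨φ x, ?_, h _ _ b₂ φ hφ⟩
  have h1 : (commutator F₁).map φ ≤ commutator F₂ := by
    rw [commutator_def, commutator_def, Subgroup.map_commutator]
    exact Subgroup.commutator_mono le_top le_top
  exact h1 ⟨x, hx, rfl⟩

theorem fHatPrime_le {ι₁ F₁ ι₂ F₂ : Type*} [Finite ι₁] [Nontrivial ι₁] [Nontrivial ι₂]
    [Group F₁] [Group F₂] (b₁ : FreeGroupBasis ι₁ F₁) (b₂ : FreeGroupBasis ι₂ F₂) (g : ℕ) :
    fHatPrime F₁ g ≤ fHatPrime F₂ g := by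
  refine iSup₂_le fun x hx => ?_
  obtain ⟨y, hy, h1, h2, -⟩ := exists_hom_le_counts b₁ b₂ hx.1
  exact h2.trans (le_iSup₂_of_le y ⟨hy, h1.trans hx.2⟩ le_rfl)

theorem fHat_le {ι₁ F₁ ι₂ F₂ : Type*} [Finite ι₁] [Nontrivial ι₁] [Nontrivial ι₂]
    [Group F₁] [Group F₂] (b₁ : FreeGroupBasis ι₁ F₁) (b₂ : FreeGroupBasis ι₂ F₂) (g : ℕ) :
    fHat F₁ g ≤ fHat F₂ g := by
  refine iSup₂_le fun x hx => ?_
  obtain ⟨y, hy, h1, -, h3⟩ := exists_hom_le_counts b₁ b₂ hx.1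
  exact h3.trans (le_iSup₂_of_le y ⟨hy, h1.trans hx.2⟩ le_rfl)

theorem mainTheorem10 {ι₁ : Type*} {F₁ : Type*} [Finite ι₁] [Nontrivial ι₁]
    [Group F₁] (b₁ : FreeGroupBasis ι₁ F₁) :
    (∀ x ∈ commutator F₁, ∃ α : ℝ, 0 < α ∧
      ∀ (ι₂ : Type*) (F₂ : Type*) [Finite ι₂] [Nontrivial ι₂] [Group F₂]
        (b₂ : FreeGroupBasis ι₂ F₂) (φ : F₁ →* F₂), IsAlphaMap b₁ b₂ α φ →
        minNumImages (φ x) ≥ minNumImages x ∧ minNumClasses (φ x) ≥ minNumClasses x) ∧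
    (∀ (ι₂ : Type*) (F₂ : Type*) [Finite ι₂] [Nontrivial ι₂] [Group F₂]
        (_b₂ : FreeGroupBasis ι₂ F₂) (g : ℕ),
        fHatPrime F₁ g = fHatPrime F₂ g ∧ fHat F₁ g = fHat F₂ g) := by
  refine ⟨fun x hx => ?_, fun ι₂ F₂ _ _ _ b₂ g => ⟨?_, ?_⟩⟩
  · obtain ⟨α, hα, h⟩ := exists_alpha b₁ hx
    exact ⟨α, hα, fun ι₂ F₂ _ _ _ b₂ φ hφ => (h ι₂ F₂ b₂ φ hφ).2⟩
  · exact le_antisymm (fHatPrime_le b₁ b₂ g) (fHatPrime_le b₂ b₁ g)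
  · exact le_antisymm (fHat_le b₁ b₂ g) (fHat_le b₂ b₁ g)
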